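/- Let $k\ge 1$ be an integer, let $\lambda_1,\dots,\lambda_k>0$ and $\mu_1,\dots,\mu_k>0$, and let $0<\alpha\le 1$. On a probability space, let $\{M_1(t)\}_{t\ge0}$ and $\{M_2(t)\}_{t\ge 0}$ be independent generalized counting processes with rates $\lambda_1,\dots,\lambda_k$ and $\mu_1,\dots,\mu_k$, respectively. Here a generalized counting process with rates $\lambda_1,\dots,\lambda_k$ is a Lévy process $M$ with values in $\{0,1,2,\dots\}$ such that, as $h\downarrow0$, $\Pr\{M(t+h)=n\mid M(t)=m\}$ equals $1-(\lambda_1+\dots+\lambda_k)h+o(h)$ for $n=m$, equals $\lambda_jh+o(h)$ for $n=m+j$, $1\le j\le k$, and equals $o(h)$ for $n>m+k$, for all $t\ge 0$ and all $m$ with $\Pr\{M(t)=m\}>0$. Let $\mathcal S(t)=M_1(t)-M_2(t)$. If $\alpha<1$, let $\{D_\alpha(t)\}_{t\ge0}$ be an $\alpha$-stable subordinator, that is, a non-decreasing Lévy process with $\mathbb E(e^{-sD_\alpha(t)})=e^{-ts^\alpha}$ for $s>0$, let $Y_\alpha(t)=\inf\{x\ge0: D_\alpha(x)>t\}$, assume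 that the process $\{Y_\alpha(t)\}$ is independent of $\{\mathcal S(t)\}$, and put $\mathcal S^\alpha(t)=\mathcal S(Y_\alpha(t))$. If $\alpha=1$, put $\mathcal S^1(t)=\mathcal S(t)$. Let $\{D_f(t)\}_{t\ge0}$ be a subordinator (a non-negative, non-decreasing Lévy process) with $\mathbb E(D_f(t)^q)<\infty$ for all $q>0$ and $t\ge 0$ that is independent of the process $\{\mathcal S^\alpha(t)\}_{t\ge 0}$, and put $$\mathcal Z_f^\alpha(t)=\mathcal S^\alpha(D_f(t)).$$ (Lévy processes start at $0$ almost surely and have almost surely càdlàg paths.) Then, for every integer $r\ge1$ and every $t\ge0$, the random variable $\mathcal Z_f^\alpha(t)(\mathcal Z_f^\alpha(t)-1)\cdots(\mathcal Z_f^\alpha(t)-r+1)$ is integrable, and $$\mathbb E\big(\mathcal Z_f^\alpha(t)(\mathcal Z_f^\alpha(t)-1)\cdots(\mathcal Z_f^\alpha(t)-r+1)\big)=r!\sum_{n=1}^{r}\frac{\mathbb E\big(D_f(t)^{n\alpha}\big)}{\Gamma(n\alpha+1)}\ \sum_{\substack{m_1+\dots+m_n=r\\ m_i\ge1}}\ \prod_{l=1}^{n}\Big(\frac1{m_l!}\sum_{j=1}^{k}\big((j)_{m_l}\lambda_j+(-1)^{m_l}j^{(m_l)}\mu_j\big)\Big),$$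 where the $m_i$ are positive integers, $(j)_m=j(j-1)\cdots(j-m+1)$ and $j^{(m)}=j(j+1)\cdots(j+m-1)$. -/

import Mathlib

open MeasureTheory ProbabilityTheory Filter Topology Asymptotics
open scoped NNReal

namespace Skellam

/-- A real-valued Lévy process: started at `0` a.s., with independent and stationary increments,
stochastically continuous, and with a.s. càdlàg paths. -/
structure IsLevyProcess {Ω : Type*} [MeasurableSpace Ω] (X : ℝ≥0 → Ω → ℝ) (P : Measure Ω) :
    Prop where
  measurable : ∀ t, Measurable (X t)
  zero : ∀ᵐ ω ∂P, X 0 ω = 0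
  indep : HasIndepIncrements X P
  stationary : ∀ s h : ℝ≥0,
    IdentDistrib (fun ω => X (s + h) ω - X s ω) (fun ω => X h ω - X 0 ω) P P
  stochCont : ∀ t : ℝ≥0, TendstoInMeasure P X (𝓝 t) (X t)
  cadlag : ∀ᵐ ω ∂P, ∀ t : ℝ≥0,
    ContinuousWithinAt (fun s => X s ω) (Set.Ici t) t ∧
      ∃ l : ℝ, Tendsto (fun s => X s ω) (𝓝[<] t) (𝓝 l)

/-- A (finite) subordinator: a Lévy process with values in `[0, ∞)` whose paths are a.s.
non-decreasing. -/
structure IsSubordinator {Ω : Type*} [MeasurableSpace Ω] (D : ℝ≥0 → Ω → ℝ≥0) (P : Measure Ω) :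
    Prop where
  levy : IsLevyProcess (fun t ω => (D t ω : ℝ)) P
  mono : ∀ᵐ ω ∂P, Monotone fun t => D t ω

/-- An `α`-stable subordinator: a subordinator with Laplace exponent `s ↦ s ^ α`. -/
structure IsStableSubordinator {Ω : Type*} [MeasurableSpace Ω] (α : ℝ)
    (D : ℝ≥0 → Ω → ℝ≥0) (P : Measure Ω) : Prop where
  subordinator : IsSubordinator D P
  laplace : ∀ (t : ℝ≥0) (s : ℝ), 0 < s →
    ∫ ω, Real.exp (-s * (D t ω : ℝ)) ∂P = Real.exp (-(t : ℝ) * s ^ α)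

/-- The first passage time `H(t) = inf {x ≥ 0 : D(x) > t}`, i.e. the inverse of `D`. -/
noncomputable def firstPassage {Ω : Type*} (D : ℝ≥0 → Ω → ℝ≥0) (t : ℝ≥0) (ω : Ω) : ℝ≥0 :=
  sInf {x : ℝ≥0 | t < D x ω}

/-- A generalized counting process with jumps of sizes `1, …, k` at the rates
`lam 1, …, lam k`: a Lévy process with values in `ℕ`, with the prescribed transition probabilities
over infinitesimal intervals `[t, t + h]`. The transition probabilities out of a state `m` at
time `t` are considered only if that state has positive probability at that time. -/
structure IsGCP {Ω : Type*} [MeasurableSpace Ω] (k : ℕ) (lam : ℕ → ℝ)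
    (M : ℝ≥0 → Ω → ℕ) (P : Measure Ω) : Prop where
  levy : IsLevyProcess (fun t ω => (M t ω : ℝ)) P
  stay : ∀ (t : ℝ≥0) (m : ℕ), P {ω | M t ω = m} ≠ 0 →
    (fun h : ℝ≥0 => (cond P {ω | M t ω = m}).real {ω | M (t + h) ω = m}
        - (1 - (∑ j ∈ Finset.Icc 1 k, lam j) * (h : ℝ)))
      =o[𝓝[>] (0 : ℝ≥0)] fun h : ℝ≥0 => (h : ℝ)
  jump : ∀ (t : ℝ≥0) (m : ℕ), P {ω | M t ω = m} ≠ 0 → ∀ j ∈ Finset.Icc 1 k,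
    (fun h : ℝ≥0 => (cond P {ω | M t ω = m}).real {ω | M (t + h) ω = m + j} - lam j * (h : ℝ))
      =o[𝓝[>] (0 : ℝ≥0)] fun h : ℝ≥0 => (h : ℝ)
  large : ∀ (t : ℝ≥0) (m : ℕ), P {ω | M t ω = m} ≠ 0 → ∀ n : ℕ, m + k < n →
    (fun h : ℝ≥0 => (cond P {ω | M t ω = m}).real {ω | M (t + h) ω = n})
      =o[𝓝[>] (0 : ℝ≥0)] fun h : ℝ≥0 => (h : ℝ)

/-- The Skellam-type difference `S(t) = M₁(t) - M₂(t)`. -/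
def gsp {Ω : Type*} (M₁ M₂ : ℝ≥0 → Ω → ℕ) (t : ℝ≥0) (ω : Ω) : ℤ :=
  (M₁ t ω : ℤ) - (M₂ t ω : ℤ)

/-- The fractional version `S^α(t)` of `S`: it is `S(Y_α(t))` for `α ≠ 1`, where `Y_α` is the
first passage time of the process `Dst` (the `α`-stable subordinator), and `S(t)` for `α = 1`. -/
noncomputable def gfsp {Ω : Type*} (α : ℝ) (S : ℝ≥0 → Ω → ℤ) (Dst : ℝ≥0 → Ω → ℝ≥0)
    (t : ℝ≥0) (ω : Ω) : ℤ :=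
  if α = 1 then S t ω else S (firstPassage Dst t ω) ω

/-- The time-changed process `Z(t) = X(D(t))`. -/
def timeChange {Ω : Type*} (X : ℝ≥0 → Ω → ℤ) (D : ℝ≥0 → Ω → ℝ≥0) (t : ℝ≥0) (ω : Ω) : ℤ :=
  X (D t ω) ω

/-- The `n`-tuples `(m₁, …, mₙ)` of positive integers with sum `r`. -/
def posTuples (n r : ℕ) : Finset (Fin n → ℕ) :=
  (Finset.Nat.antidiagonalTuple n r).filter fun m => ∀ i, 1 ≤ m i

end Skellam

namespace Skellam

/-! ### Power series: uniqueness, exponentials, binomial series -/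

section PowerSeriesTools

/-! Factorial moments are Taylor coefficients: for an integer `s`, `(1 + x) ^ s = ∑ choose(s, r) x ^
r` when `|x| < 1`. The moments of `S(y)` at a deterministic time `y` are therefore read off from `𝔼
(1 + x) ^ S(y)`.

For one counting process, stationary independent increments make `𝔼 z ^ M(t)` multiplicative in `t`,
and the small-time probabilities give its derivative at `0`; hence it is `exp (t ∑ λ_j (z ^ j - 1))`
on the closed unit disc. The right side is entire in `z`, so all exponential moments exist and the
formula holds for every real `u ≥ 0` (`IsGCP.integral_pow`). By independence, `𝔼 (1 + x) ^ S(y) =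
exp (y φ(x))`, where `φ` has the coefficients `exponentCoeff`. Expanding the exponential and
comparing coefficients (`integral_choose_gsp`) shows that the `r`-th factorial moment of `S(y)` is a
polynomial in `y`, whose coefficient of `y ^ n` is `r! / n!` times a sum over compositions of `r`
into `n` parts.

An independent random time then only has to be averaged over this polynomial
(`integral_comp_randomTime`). This is used twice. Averaging over the inverse stable subordinator at
`d` turns `y ^ n` into `n! d ^ (nα) / Γ(nα + 1)` (`firstPassage_moment`), because the inverse at `d`
has the law of `(d / D(1)) ^ α`. Averaging over the outer subordinator replaces `d ^ (nα)` by its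
mean, and the two `n!` cancel.

Integrability along a random time needs control of `𝔼 |f(S(y))|`, which has no closed form. It is at
most `1 + 𝔼 f(S(y)) ^ 2`, and this is again a polynomial in `y`, since falling factorials span all
polynomials. -/

theorem hasFPowerSeriesOnBall_ofScalars_of_hasSum {𝕜 : Type*} [RCLike 𝕜] {a : ℕ → 𝕜} {f : 𝕜 → 𝕜}
    {ρ : ℝ≥0} (hρ : 0 < ρ)
    (h : ∀ x : 𝕜, ‖x‖ < ρ → HasSum (fun n => a n * x ^ n) (f x)) :
    HasFPowerSeriesOnBall f (FormalMultilinearSeries.ofScalars 𝕜 a) 0 ρ where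
  r_le := by
    refine ENNReal.le_of_forall_nnreal_lt fun s hs => ?_
    have hs' : s < ρ := by exact_mod_cast hs
    refine FormalMultilinearSeries.le_radius_of_tendsto _ (l := 0) ?_
    have h1 := (h ((s : ℝ) : 𝕜) (by simpa using hs')).summable.tendsto_atTop_zero.norm
    simpa [FormalMultilinearSeries.ofScalars_norm, abs_of_nonneg s.2] using h1
  r_pos := by exact_mod_cast hρ
  hasSum := by
    intro y hy
    have hy' : ‖y‖ < ρ := by
      simpa [Metric.mem_eball, edist_zero_right, enorm_eq_nnnorm] using hy
    have h1 := h y hy'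
    simpa [FormalMultilinearSeries.ofScalars_apply_eq, mul_comm] using h1

theorem coeff_unique_of_hasSum {𝕜 : Type*} [RCLike 𝕜] {a b : ℕ → 𝕜} {f : 𝕜 → 𝕜} {ρ : ℝ≥0}
    (hρ : 0 < ρ) (ha : ∀ x : 𝕜, ‖x‖ < ρ → HasSum (fun n => a n * x ^ n) (f x))
    (hb : ∀ x : 𝕜, ‖x‖ < ρ → HasSum (fun n => b n * x ^ n) (f x)) : a = b := by
  have h1 := (hasFPowerSeriesOnBall_ofScalars_of_hasSum hρ ha).hasFPowerSeriesAt
  have h2 := (hasFPowerSeriesOnBall_ofScalars_of_hasSum hρ hb).hasFPowerSeriesAt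
  exact FormalMultilinearSeries.ofScalars_series_injective 𝕜 𝕜 (h1.eq_formalMultilinearSeries h2)

/-- A power series that represents an entire function near the origin represents it everywhere. -/
theorem hasSum_of_differentiable {a : ℕ → ℂ} {f : ℂ → ℂ} {ρ : ℝ≥0} (hρ : 0 < ρ)
    (h : ∀ x : ℂ, ‖x‖ < ρ → HasSum (fun n => a n * x ^ n) (f x)) (hf : Differentiable ℂ f)
    (z : ℂ) : HasSum (fun n => a n * z ^ n) (f z) := by
  have h1 := hasFPowerSeriesOnBall_ofScalars_of_hasSum hρ h
  have h2 := h1.exchange_radius (hf.hasFPowerSeriesOnBall 0 one_pos)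
  have h3 := h2.hasSum (y := z) (by simp)
  simpa [FormalMultilinearSeries.ofScalars_apply_eq, mul_comm] using h3

theorem hasSum_coeff_mk_pow {b : ℕ → ℝ} (hb : Summable fun m => |b m|) (n : ℕ) :
    Summable (fun r => |PowerSeries.coeff r (PowerSeries.mk b ^ n)|) ∧
      HasSum (fun r => PowerSeries.coeff r (PowerSeries.mk b ^ n)) ((∑' m, b m) ^ n) := by
  induction n with
  | zero =>
    have h : (fun r => PowerSeries.coeff r (PowerSeries.mk b ^ 0)) = Pi.single 0 (1 : ℝ) := by
      ext r
      simp [PowerSeries.coeff_one, Pi.single_apply]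
    have h' : HasSum (Pi.single 0 (1 : ℝ) : ℕ → ℝ) 1 := hasSum_pi_single 0 1
    rw [← h] at h'
    exact ⟨h'.summable.abs, by simpa only [pow_zero] using h'⟩
  | succ n ih =>
    have hn := ih.1
    have h1 : ∀ r, PowerSeries.coeff r (PowerSeries.mk b ^ (n + 1)) =
        ∑ kl ∈ Finset.HasAntidiagonal.antidiagonal r,
          PowerSeries.coeff kl.1 (PowerSeries.mk b ^ n) * b kl.2 := by
      intro r
      rw [pow_succ, PowerSeries.coeff_mul]
      simp
    have hs := summable_norm_sum_mul_antidiagonal_of_summable_norm (R := ℝ) hn hb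
    have ht := tsum_mul_tsum_eq_tsum_sum_antidiagonal_of_summable_norm (R := ℝ) hn hb
    simp only [h1]
    refine ⟨hs, ?_⟩
    rw [pow_succ, ← ih.2.tsum_eq, ht]
    exact (Summable.of_norm hs).hasSum

theorem abs_coeff_mk_pow_le (b : ℕ → ℝ) (n r : ℕ) :
    |PowerSeries.coeff r (PowerSeries.mk b ^ n)| ≤
      PowerSeries.coeff r (PowerSeries.mk (fun m => |b m|) ^ n) := by
  induction n generalizing r with
  | zero =>
    simp only [pow_zero, PowerSeries.coeff_one]
    split_ifs <;> simp
  | succ n ih =>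
    simp only [pow_succ, PowerSeries.coeff_mul, PowerSeries.coeff_mk]
    refine (Finset.abs_sum_le_sum_abs _ _).trans (Finset.sum_le_sum fun p _ => ?_)
    rw [abs_mul]
    exact mul_le_mul_of_nonneg_right (ih _) (abs_nonneg _)

/-- Expand the exponential and every power of the series, then sum the double series in the other
order; `exp (|y| ∑ |b m|)` dominates it. Since `b 0 = 0`, the `n`-th power starts at degree `n`, so
only `n ≤ r` contribute to the coefficient `r`. -/
theorem hasSum_exp_mk {b : ℕ → ℝ} (hb : Summable fun m => |b m|) (hb0 : b 0 = 0) (y : ℝ) :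
    HasSum (fun r => ∑ n ∈ Finset.range (r + 1),
      y ^ n / (n.factorial : ℝ) * PowerSeries.coeff r (PowerSeries.mk b ^ n))
      (Real.exp (y * ∑' m, b m)) := by
  set F : ℕ × ℕ → ℝ := fun p =>
    y ^ p.1 / (p.1.factorial : ℝ) * PowerSeries.coeff p.2 (PowerSeries.mk b ^ p.1) with hF
  have hB : Summable fun m => |(|b m|)| := by simpa using hb
  have hsum : Summable F := by
    refine Summable.of_norm ?_
    rw [summable_prod_of_nonneg fun _ => norm_nonneg _]
    constructor
    · intro n
      simp only [hF, norm_mul, Real.norm_eq_abs]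
      exact (hasSum_coeff_mk_pow hb n).1.mul_left _
    · refine Summable.of_nonneg_of_le (fun n => tsum_nonneg fun _ => norm_nonneg _) (fun n => ?_)
        (Real.summable_pow_div_factorial (|y| * ∑' m, |b m|))
      simp only [hF, norm_mul, Real.norm_eq_abs]
      rw [tsum_mul_left, abs_div, abs_pow, mul_pow, Nat.abs_cast, mul_div_right_comm]
      refine mul_le_mul_of_nonneg_left ?_ (by positivity)
      rw [← (hasSum_coeff_mk_pow hB n).2.tsum_eq]
      exact Summable.tsum_le_tsum (fun r => abs_coeff_mk_pow_le b n r)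
        (hasSum_coeff_mk_pow hb n).1 (hasSum_coeff_mk_pow hB n).2.summable
  have h1 : HasSum F (Real.exp (y * ∑' m, b m)) := by
    have h2 := hsum.hasSum.prod_fiberwise
      (fun n => ((hasSum_coeff_mk_pow hb n).2.mul_left (y ^ n / (n.factorial : ℝ))))
    have h3 : HasSum (fun n : ℕ => y ^ n / (n.factorial : ℝ) * (∑' m, b m) ^ n)
        (Real.exp (y * ∑' m, b m)) := by
      have := NormedSpace.expSeries_div_hasSum_exp (y * ∑' m, b m)
      rw [← Real.exp_eq_exp_ℝ] at this
      simpa only [mul_pow, mul_div_right_comm] using this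
    rw [← h2.unique h3]
    exact hsum.hasSum
  have h4 := (Equiv.prodComm ℕ ℕ).hasSum_iff.mpr h1
  refine h4.prod_fiberwise fun r => ?_
  have h5 : ∀ n ∉ Finset.range (r + 1), F (n, r) = 0 := by
    intro n hn
    have hX : (PowerSeries.X : PowerSeries ℝ) ∣ PowerSeries.mk b := by
      rw [PowerSeries.X_dvd_iff]
      simpa using hb0
    have := (PowerSeries.X_pow_dvd_iff.mp (pow_dvd_pow_of_dvd hX n)) r
      (by simpa using hn)
    simp [hF, this]
  exact hasSum_sum_of_ne_finset_zero h5

theorem coeff_mk_pow_eq_sum_posTuples {c : ℕ → ℝ} (hc : c 0 = 0) (n r : ℕ) :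
    PowerSeries.coeff r (PowerSeries.mk c ^ n) = ∑ m ∈ posTuples n r, ∏ l : Fin n, c (m l) := by
  have h1 : PowerSeries.mk c ^ n = ∏ _l : Fin n, PowerSeries.mk c := by simp
  rw [h1, PowerSeries.coeff_prod, posTuples, Finset.sum_filter_of_ne]
  · refine Finset.sum_nbij' (fun m => ⇑m) (fun m => Finsupp.equivFunOnFinite.symm m) ?_ ?_ ?_ ?_ ?_
    · intro m hm
      simpa [Finset.Nat.mem_antidiagonalTuple] using hm
    · intro m hm
      simpa [Finset.Nat.mem_antidiagonalTuple] using hm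
    · intro m _
      ext; simp
    · intro m _
      ext; simp
    · intro m _
      simp
  · intro m _ hne i
    by_contra h0
    exact hne (Finset.prod_eq_zero (Finset.mem_univ i) (by
      rw [Nat.lt_one_iff.mp (not_le.mp h0), hc]))

theorem hasSum_exp_powerSeries {c : ℕ → ℝ} {x φ : ℝ} (hc0 : c 0 = 0)
    (hφ : HasSum (fun m => c m * x ^ m) φ) (y : ℝ) :
    HasSum (fun r => (∑ n ∈ Finset.range (r + 1),
      y ^ n / (n.factorial : ℝ) * ∑ m ∈ posTuples n r, ∏ l : Fin n, c (m l)) * x ^ r)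
      (Real.exp (y * φ)) := by
  have h1 := hasSum_exp_mk (b := fun m => c m * x ^ m) hφ.summable.abs (by simp [hc0]) y
  rw [hφ.tsum_eq] at h1
  convert h1 using 2 with r
  rw [Finset.sum_mul]
  refine Finset.sum_congr rfl fun n _ => ?_
  have h2 : PowerSeries.mk (fun m => c m * x ^ m) = PowerSeries.rescale x (PowerSeries.mk c) := by
    ext m
    simp [PowerSeries.coeff_rescale, mul_comm]
  rw [h2, ← map_pow, PowerSeries.coeff_rescale, coeff_mk_pow_eq_sum_posTuples hc0]
  ring

theorem multichoose_natCast_eq (n r : ℕ) :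
    Ring.multichoose (n : ℝ) r = (n.ascFactorial r : ℝ) / (r.factorial : ℝ) := by
  have h := Ring.factorial_nsmul_multichoose_eq_ascPochhammer (n : ℝ) r
  rw [Polynomial.ascPochhammer_smeval_eq_eval, ← ascPochhammer_eval_cast,
    ascPochhammer_nat_eq_ascFactorial, nsmul_eq_mul] at h
  rw [← h]
  field_simp

theorem choose_natCast_eq (n r : ℕ) :
    Ring.choose (n : ℝ) r = (n.descFactorial r : ℝ) / (r.factorial : ℝ) := by
  rw [Ring.choose_natCast, Nat.descFactorial_eq_factorial_mul_choose]
  push_cast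
  field_simp

theorem choose_neg_natCast_eq (n r : ℕ) :
    Ring.choose (-(n : ℝ)) r = (-1) ^ r * ((n.ascFactorial r : ℝ) / (r.factorial : ℝ)) := by
  rw [Ring.choose_neg', multichoose_natCast_eq]
  simp [Units.smul_def, Int.negOnePow_def]

theorem hasSum_choose_mul_pow (s : ℤ) {x : ℝ} (hx : |x| < 1) :
    HasSum (fun r => Ring.choose (s : ℝ) r * x ^ r) ((1 + x) ^ s) := by
  have h := (Real.one_add_rpow_hasFPowerSeriesOnBall_zero (a := (s : ℝ))).hasSum (y := x) (by
    simpa [Metric.mem_eball, edist_zero_right, enorm_eq_nnnorm, ← NNReal.coe_lt_coe] using hx)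
  simpa [binomialSeries, FormalMultilinearSeries.ofScalars_apply_eq, mul_comm] using h

/-- For `s ≥ 0` the coefficients are nonnegative and the sum is `(1 + |x|) ^ s`; for `s = -n` they
alternate in sign, so the sum is the series at `-|x|`, namely `(1 - |x|) ^ (-n)`. The common bound
dominates when expectation and binomial series are exchanged. -/
theorem hasSum_abs_choose_mul_pow_le (s : ℤ) {x : ℝ} (hx : |x| < 1) :
    Summable (fun r => |Ring.choose (s : ℝ) r * x ^ r|) ∧
      ∑' r, |Ring.choose (s : ℝ) r * x ^ r| ≤ (1 - |x|)⁻¹ ^ s.natAbs := by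
  refine ⟨(hasSum_choose_mul_pow s hx).summable.abs, ?_⟩
  have hx0 : 0 < 1 - |x| := by linarith
  obtain ⟨n, rfl | rfl⟩ := s.eq_nat_or_neg
  · have h := hasSum_choose_mul_pow (n : ℤ) (x := |x|) (by simpa using hx)
    have h1 : ∀ r, |Ring.choose (((n : ℤ) : ℝ)) r * x ^ r| =
        Ring.choose (((n : ℤ) : ℝ)) r * |x| ^ r := by
      intro r
      rw [abs_mul, abs_pow, abs_of_nonneg]
      rw [Int.cast_natCast, choose_natCast_eq]
      positivity
    simp only [h1]
    rw [h.tsum_eq, zpow_natCast, Int.natAbs_natCast]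
    refine pow_le_pow_left₀ (by positivity) ?_ _
    rw [le_inv_comm₀ (by positivity) hx0, inv_eq_one_div, le_div_iff₀ (by positivity)]
    nlinarith [sq_nonneg |x|]
  · have h := hasSum_choose_mul_pow (-(n : ℤ)) (x := -|x|) (by simpa using hx)
    have h1 : ∀ r, |Ring.choose (((-(n : ℤ) : ℤ) : ℝ)) r * x ^ r| =
        Ring.choose (((-(n : ℤ) : ℤ) : ℝ)) r * (-|x|) ^ r := by
      intro r
      rw [abs_mul, abs_pow]
      push_cast
      rw [choose_neg_natCast_eq, abs_mul, neg_pow |x|, abs_of_nonneg (by positivity :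
        (0 : ℝ) ≤ (n.ascFactorial r : ℝ) / (r.factorial : ℝ))]
      have e : (-1 : ℝ) ^ r * (-1) ^ r = 1 := by rw [← mul_pow]; simp
      rw [abs_pow, abs_neg, abs_one, one_pow]
      linear_combination (-((n.ascFactorial r : ℝ) / (r.factorial : ℝ)) * |x| ^ r) * e
    simp only [h1]
    rw [h.tsum_eq, Int.natAbs_neg, Int.natAbs_natCast, zpow_neg, zpow_natCast, ← inv_pow,
      ← sub_eq_add_neg]

end PowerSeriesTools

/-! ### Generating function of a generalized counting process -/

section GeneratingFunction

variable {Ω : Type*} [MeasurableSpace Ω] {P : Measure Ω}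

theorem measurable_of_levy_natCast {M : ℝ≥0 → Ω → ℕ}
    (hM : IsLevyProcess (fun t ω => (M t ω : ℝ)) P) (t : ℝ≥0) : Measurable (M t) := by
  have h := (Nat.measurable_floor (R := ℝ)).comp (hM.measurable t)
  simpa only [Function.comp_def, Nat.floor_natCast] using h

theorem integrable_pow_of_norm_le_one [IsProbabilityMeasure P] {N : Ω → ℕ} (hN : Measurable N)
    {z : ℂ} (hz : ‖z‖ ≤ 1) : Integrable (fun ω => z ^ N ω) P := by
  refine Integrable.of_bound (C := 1)
    ((Measurable.of_discrete (f := fun n : ℕ => z ^ n)).comp hN).aestronglyMeasurable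
    (ae_of_all _ fun ω => ?_)
  rw [norm_pow]
  exact pow_le_one₀ (norm_nonneg _) hz

theorem integral_pow_add_of_levy [IsProbabilityMeasure P] {M : ℝ≥0 → Ω → ℕ}
    (hM : IsLevyProcess (fun t ω => (M t ω : ℝ)) P) (z : ℂ) (s h : ℝ≥0) :
    ∫ ω, z ^ M (s + h) ω ∂P = (∫ ω, z ^ M s ω ∂P) * ∫ ω, z ^ M h ω ∂P := by
  -- The floor extends `n ↦ z ^ n` to real arguments, so that it applies to real increments; it is
  -- harmless because increments are a.s. nonnegative, as `h1` obtains by equality in law.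
  have hφ : Measurable fun x : ℝ => z ^ ⌊x⌋₊ :=
    (Measurable.of_discrete (f := fun n : ℕ => z ^ n)).comp Nat.measurable_floor
  have hind := (hM.indep.indepFun_eval_sub (zero_le : 0 ≤ s) (le_self_add : s ≤ s + h)
    hM.zero).comp hφ hφ
  have hid := hM.stationary s h
  have h0 : ∀ᵐ ω ∂P, (0 : ℝ) ≤ (M h ω : ℝ) - M 0 ω := by
    filter_upwards [hM.zero] with ω hω
    rw [hω, sub_zero]
    positivity
  have h1 : ∀ᵐ ω ∂P, (0 : ℝ) ≤ (M (s + h) ω : ℝ) - M s ω :=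
    hid.symm.ae_snd (p := fun x => 0 ≤ x) measurableSet_Ici h0
  have h2 : ∫ ω, z ^ ⌊(M (s + h) ω : ℝ) - M s ω⌋₊ ∂P = ∫ ω, z ^ M h ω ∂P := by
    refine (hid.comp hφ).integral_eq.trans ?_
    refine integral_congr_ae ?_
    filter_upwards [hM.zero] with ω hω
    simp [hω]
  have h3 := hind.integral_fun_mul_eq_mul_integral
    (hφ.comp (hM.measurable s)).aestronglyMeasurable
    (hφ.comp ((hM.measurable (s + h)).sub (hM.measurable s))).aestronglyMeasurable
  simp only [Function.comp_apply, Nat.floor_natCast, Pi.sub_apply] at h3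
  rw [h2] at h3
  rw [← h3]
  refine integral_congr_ae ?_
  filter_upwards [h1] with ω hω
  have hle : M s ω ≤ M (s + h) ω := by exact_mod_cast sub_nonneg.mp hω
  rw [← Nat.cast_sub hle, Nat.floor_natCast, ← pow_add, Nat.add_sub_cancel' hle]

theorem integral_pow_natCast_mul_of_levy [IsProbabilityMeasure P] {M : ℝ≥0 → Ω → ℕ}
    (hM : IsLevyProcess (fun t ω => (M t ω : ℝ)) P) (z : ℂ) (h : ℝ≥0) (n : ℕ) :
    ∫ ω, z ^ M (n * h) ω ∂P = (∫ ω, z ^ M h ω ∂P) ^ n := by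
  induction n with
  | zero =>
    have : ∀ᵐ ω ∂P, z ^ M ((0 : ℕ) * h) ω = 1 := by
      filter_upwards [hM.zero] with ω hω
      have : M 0 ω = 0 := by exact_mod_cast hω
      simp [this]
    rw [integral_congr_ae this]
    simp
  | succ n ih =>
    rw [pow_succ, ← ih, ← integral_pow_add_of_levy hM]
    congr! 4
    push_cast
    ring

/-- The exponent of the probability generating function of a generalized counting process. -/
noncomputable def jumpExponent {𝕜 : Type*} [RCLike 𝕜] (k : ℕ) (lam : ℕ → ℝ) (z : 𝕜) : 𝕜 :=
  ∑ j ∈ Finset.Icc 1 k, (lam j : 𝕜) * (z ^ j - 1)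

theorem jumpExponent_complex (k : ℕ) (lam : ℕ → ℝ) (z : ℂ) :
    jumpExponent k lam z = ∑ j ∈ Finset.Icc 1 k, (lam j : ℂ) * (z ^ j - 1) := rfl

theorem jumpExponent_real (k : ℕ) (lam : ℕ → ℝ) (x : ℝ) :
    jumpExponent k lam x = ∑ j ∈ Finset.Icc 1 k, lam j * (x ^ j - 1) := rfl

/-- The difference is the integral of `z ^ N - 1` over `{N > k}`, where the integrand has norm at
most `2`. -/
theorem norm_integral_pow_sub_le [IsProbabilityMeasure P] {N : Ω → ℕ} (hN : Measurable N)
    {z : ℂ} (hz : ‖z‖ ≤ 1) (k : ℕ) :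
    ‖∫ ω, z ^ N ω ∂P - 1 - ∑ j ∈ Finset.Icc 1 k, (P.real {ω | N ω = j} : ℂ) * (z ^ j - 1)‖ ≤
      2 * (1 - P.real {ω | N ω = 0} - ∑ j ∈ Finset.Icc 1 k, P.real {ω | N ω = j}) := by
  have hms : ∀ j, MeasurableSet {ω | N ω = j} := fun j => hN (measurableSet_singleton j)
  have hmk : MeasurableSet {ω | k < N ω} := hN measurableSet_Ioi
  have hI := integrable_pow_of_norm_le_one (P := P) hN hz
  have hdec : ∀ (f : ℕ → ℂ) (ω : Ω), f (N ω) = {ω | N ω = 0}.indicator (fun _ => f 0) ω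
      + ∑ j ∈ Finset.Icc 1 k, {ω | N ω = j}.indicator (fun _ => f j) ω
      + {ω | k < N ω}.indicator (fun ω => f (N ω)) ω := by
    intro f ω
    simp only [Set.indicator_apply, Set.mem_ofPred_eq]
    rw [Finset.sum_ite_eq]
    rcases Nat.eq_zero_or_pos (N ω) with h0 | h0
    · simp [h0]
    · rcases le_or_gt (N ω) k with h1 | h1
      · simp [h0.ne', h1, Nat.one_le_iff_ne_zero, not_lt.mpr h1]
      · simp [h0.ne', h1, not_le.mpr h1]
  have hind : ∀ (j : ℕ) (c : ℂ), Integrable ({ω | N ω = j}.indicator fun _ => c) P :=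
    fun j c => (integrable_const c).indicator (hms j)
  have hint : ∀ (j : ℕ) (c : ℂ), ∫ ω, {ω | N ω = j}.indicator (fun _ => c) ω ∂P =
      (P.real {ω | N ω = j} : ℂ) * c := by
    intro j c
    rw [integral_indicator_const _ (hms j)]
    simp
  have hgen : ∀ f : ℕ → ℂ, Integrable (fun ω => f (N ω)) P → ∫ ω, f (N ω) ∂P =
      (P.real {ω | N ω = 0} : ℂ) * f 0
      + ∑ j ∈ Finset.Icc 1 k, (P.real {ω | N ω = j} : ℂ) * f j
      + ∫ ω, {ω | k < N ω}.indicator (fun ω => f (N ω)) ω ∂P := by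
    intro f hf
    rw [integral_congr_ae (ae_of_all _ (hdec f)), integral_add, integral_add,
      integral_finsetSum _ (fun j _ => hind j _), hint]
    · simp only [hint]
    · exact hind _ _
    · exact integrable_finsetSum _ fun j _ => hind j _
    · exact (hind _ _).add (integrable_finsetSum _ fun j _ => hind j _)
    · exact hf.indicator hmk
  have h1 := hgen (fun n => z ^ n - 1) (hI.sub (integrable_const 1))
  rw [integral_sub hI (integrable_const 1)] at h1
  simp only [integral_const, probReal_univ, one_smul, pow_zero, sub_self, mul_zero, zero_add] at h1
  have h2 := hgen (fun n => 1) (integrable_const 1)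
  simp only [integral_const, probReal_univ, one_smul, mul_one] at h2
  rw [integral_indicator_const _ hmk] at h2
  have h3 : P.real {ω | k < N ω} =
      1 - P.real {ω | N ω = 0} - ∑ j ∈ Finset.Icc 1 k, P.real {ω | N ω = j} := by
    have : ((1 : ℝ) : ℂ) = ((P.real {ω | N ω = 0} + ∑ j ∈ Finset.Icc 1 k, P.real {ω | N ω = j}
        + P.real {ω | k < N ω} : ℝ) : ℂ) := by
      push_cast
      simpa using h2
    have := Complex.ofReal_injective this
    linarith
  rw [h1, add_sub_cancel_left, ← h3, integral_indicator hmk]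
  refine (norm_setIntegral_le_of_norm_le_const (C := 2) (measure_lt_top _ _) fun ω _ => ?_).trans
    le_rfl
  refine (norm_sub_le _ _).trans ?_
  rw [norm_pow, norm_one]
  linarith [pow_le_one₀ (n := N ω) (norm_nonneg z) hz]

theorem IsGCP.cond_zero [IsProbabilityMeasure P] {k : ℕ} {lam : ℕ → ℝ} {M : ℝ≥0 → Ω → ℕ}
    (hM : IsGCP k lam M P) : P {ω | M 0 ω = 0} = 1 ∧ cond P {ω | M 0 ω = 0} = P := by
  have h0 : ∀ᵐ ω ∂P, ω ∈ {ω | M 0 ω = 0} := by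
    filter_upwards [hM.levy.zero] with ω hω
    exact_mod_cast hω
  have h1 : P {ω | M 0 ω = 0} = 1 := (mem_ae_iff_prob_eq_one
    (measurable_of_levy_natCast hM.levy 0 (measurableSet_singleton 0))).mp h0
  refine ⟨h1, ?_⟩
  rw [ProbabilityTheory.cond, h1, inv_one, one_smul, Measure.restrict_eq_self_of_ae_mem h0]

theorem IsGCP.integral_pow_sub_isLittleO [IsProbabilityMeasure P] {k : ℕ} {lam : ℕ → ℝ}
    {M : ℝ≥0 → Ω → ℕ} (hM : IsGCP k lam M P) {z : ℂ} (hz : ‖z‖ ≤ 1) :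
    (fun h : ℝ≥0 => ∫ ω, z ^ M h ω ∂P - 1 - (h : ℂ) * jumpExponent k lam z)
      =o[𝓝[>] (0 : ℝ≥0)] fun h : ℝ≥0 => (h : ℝ) := by
  obtain ⟨h1, hc⟩ := hM.cond_zero
  have hne : P {ω | M 0 ω = 0} ≠ 0 := by rw [h1]; exact one_ne_zero
  have hstay := hM.stay 0 0 hne
  have hjump := hM.jump 0 0 hne
  simp only [hc, zero_add] at hstay hjump
  -- The probabilities of the jumps `0, …, k` add up to `1 + o(h)`, which leaves `o(h)` for all
  -- larger jumps together.
  have hrest : (fun h : ℝ≥0 => 2 * (1 - P.real {ω | M h ω = 0}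
      - ∑ j ∈ Finset.Icc 1 k, P.real {ω | M h ω = j}))
      =o[𝓝[>] (0 : ℝ≥0)] fun h : ℝ≥0 => (h : ℝ) := by
    have := ((hstay.add (IsLittleO.fun_sum hjump)).const_mul_left (-2))
    refine this.congr_left fun h => ?_
    simp only [Finset.sum_sub_distrib, Finset.sum_mul]
    ring
  have hmain : (fun h : ℝ≥0 => ∑ j ∈ Finset.Icc 1 k,
      (z ^ j - 1) * ((P.real {ω | M h ω = j} - lam j * (h : ℝ) : ℝ) : ℂ))
      =o[𝓝[>] (0 : ℝ≥0)] fun h : ℝ≥0 => (h : ℝ) := by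
    refine IsLittleO.fun_sum fun j hj => IsLittleO.const_mul_left ?_ _
    refine IsLittleO.of_norm_left ?_
    simpa only [Complex.norm_real] using (hjump j hj).norm_left
  have hdiff : (fun h : ℝ≥0 => ∫ ω, z ^ M h ω ∂P - 1
      - ∑ j ∈ Finset.Icc 1 k, (P.real {ω | M h ω = j} : ℂ) * (z ^ j - 1))
      =o[𝓝[>] (0 : ℝ≥0)] fun h : ℝ≥0 => (h : ℝ) := by
    refine (IsBigO.of_bound 1 (Eventually.of_forall fun h => ?_)).trans_isLittleO hrest
    rw [one_mul]
    exact (norm_integral_pow_sub_le (measurable_of_levy_natCast hM.levy h) hz k).trans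
      (le_abs_self _)
  refine (hdiff.add hmain).congr_left fun h => ?_
  rw [jumpExponent_complex, Finset.mul_sum]
  rw [sub_add, ← Finset.sum_sub_distrib]
  congr 1
  refine Finset.sum_congr rfl fun j _ => ?_
  push_cast
  ring

/-- Cut `[0, t]` into `n` equal steps: the value is the `n`-th power of `1 + (t / n) ψ(z) + o(1 /
n)`, with `ψ` the jump exponent, and such powers tend to the exponential. -/
theorem IsGCP.integral_pow_of_norm_le_one [IsProbabilityMeasure P] {k : ℕ} {lam : ℕ → ℝ}
    {M : ℝ≥0 → Ω → ℕ} (hM : IsGCP k lam M P) {z : ℂ} (hz : ‖z‖ ≤ 1) (t : ℝ≥0) :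
    ∫ ω, z ^ M t ω ∂P = Complex.exp (t * jumpExponent k lam z) := by
  rcases eq_or_ne t 0 with rfl | ht
  · simpa using integral_pow_natCast_mul_of_levy hM.levy z 0 0
  have htend : Tendsto (fun n : ℕ => t / (n : ℝ≥0)) atTop (𝓝[>] 0) := by
    refine tendsto_nhdsWithin_iff.mpr ⟨NNReal.tendsto_coe.mp ?_, ?_⟩
    · simpa using tendsto_const_div_atTop_nhds_zero_nat (t : ℝ)
    filter_upwards [eventually_gt_atTop 0] with n hn
    have : (0 : ℝ≥0) < n := by exact_mod_cast hn
    exact div_pos (pos_iff_ne_zero.mpr ht) this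
  have h1 := (hM.integral_pow_sub_isLittleO hz).comp_tendsto htend
  have h2 : Tendsto (fun n : ℕ => (n : ℂ) * (∫ ω, z ^ M (t / n) ω ∂P - 1)) atTop
      (𝓝 (t * jumpExponent k lam z)) := by
    rw [tendsto_iff_norm_sub_tendsto_zero]
    have h3 := (h1.norm_left.tendsto_div_nhds_zero).const_mul (t : ℝ)
    rw [mul_zero] at h3
    refine h3.congr' ?_
    filter_upwards [eventually_gt_atTop 0] with n hn
    have hn' : (n : ℝ) ≠ 0 := by exact_mod_cast hn.ne'
    have hn'' : (n : ℂ) ≠ 0 := by exact_mod_cast hn.ne'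
    have ht' : (t : ℝ) ≠ 0 := by exact_mod_cast ht
    simp only [Function.comp_apply, NNReal.coe_div, NNReal.coe_natCast]
    have : (n : ℂ) * (∫ ω, z ^ M (t / n) ω ∂P - 1) - t * jumpExponent k lam z =
        (n : ℂ) * (∫ ω, z ^ M (t / n) ω ∂P - 1
          - ((t : ℝ) / (n : ℝ) : ℝ) * jumpExponent k lam z) := by
      push_cast
      field_simp
    rw [this, norm_mul, Complex.norm_natCast]
    field_simp
  have h4 := Complex.tendsto_one_add_pow_exp_of_tendsto h2
  refine tendsto_nhds_unique (tendsto_const_nhds.congr' ?_) h4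
  filter_upwards [eventually_gt_atTop 0] with n hn
  have hn' : (n : ℝ≥0) ≠ 0 := by exact_mod_cast hn.ne'
  rw [add_sub_cancel, ← integral_pow_natCast_mul_of_levy hM.levy, mul_div_cancel₀ _ hn']

theorem hasSum_integral_pow [IsProbabilityMeasure P] {N : Ω → ℕ} (hN : Measurable N)
    {z : ℂ} (hz : ‖z‖ ≤ 1) :
    HasSum (fun n => (P.real {ω | N ω = n} : ℂ) * z ^ n) (∫ ω, z ^ N ω ∂P) := by
  have h1 : ∫ ω, z ^ N ω ∂P = ∫ n, z ^ n ∂(P.map N) :=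
    (integral_map hN.aemeasurable (by fun_prop)).symm
  have hprob : IsProbabilityMeasure (P.map N) := Measure.isProbabilityMeasure_map hN.aemeasurable
  have h2 := integrable_pow_of_norm_le_one (P := P.map N) measurable_id hz
  have h3 := hasSum_integral_iUnion (μ := P.map N) (s := fun n : ℕ => {n})
    (fun n => measurableSet_singleton n) (by intro i j hij; simpa using hij) h2.integrableOn
  rw [Set.iUnion_of_singleton, Measure.restrict_univ] at h3
  simp only [id] at h3
  rw [h1]
  refine h3.congr_fun fun n => ?_
  rw [integral_singleton, map_measureReal_apply hN (measurableSet_singleton n)]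
  simp [Set.preimage]

/-- The probability generating function of a generalized counting process, at every positive
argument. -/
theorem IsGCP.integral_pow [IsProbabilityMeasure P] {k : ℕ} {lam : ℕ → ℝ}
    {M : ℝ≥0 → Ω → ℕ} (hM : IsGCP k lam M P) {u : ℝ} (hu : 0 ≤ u) (t : ℝ≥0) :
    Integrable (fun ω => u ^ M t ω) P ∧
      ∫ ω, u ^ M t ω ∂P = Real.exp (t * jumpExponent k lam u) := by
  have hN := measurable_of_levy_natCast hM.levy t
  have hdiff : Differentiable ℂ fun z : ℂ => Complex.exp (t * jumpExponent k lam z) := by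
    unfold jumpExponent
    fun_prop
  have h1 := hasSum_of_differentiable one_pos (fun z hz => by
    rw [← hM.integral_pow_of_norm_le_one hz.le t]
    exact hasSum_integral_pow hN hz.le) hdiff u
  have h2 : HasSum (fun n => P.real {ω | M t ω = n} * u ^ n)
      (Real.exp (t * jumpExponent k lam u)) := by
    rw [← Complex.hasSum_ofReal]
    convert h1 using 1
    · ext n; push_cast; rfl
    · simp [jumpExponent_complex, jumpExponent_real]
  -- All terms are nonnegative, so summing over the values of `M t` gives integrability and the
  -- value at once, also for `u > 1`.
  have h3 : ∫⁻ ω, ENNReal.ofReal (u ^ M t ω) ∂P =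
      ENNReal.ofReal (Real.exp (t * jumpExponent k lam u)) := by
    rw [← h2.tsum_eq, ENNReal.ofReal_tsum_of_nonneg (fun n => by positivity) h2.summable,
      ← lintegral_map (f := fun n : ℕ => ENNReal.ofReal (u ^ n)) Measurable.of_discrete hN,
      lintegral_countable']
    refine tsum_congr fun n => ?_
    rw [Measure.map_apply hN (measurableSet_singleton n), ENNReal.ofReal_mul measureReal_nonneg,
      ofReal_measureReal, mul_comm]
    rfl
  have hmeas : AEStronglyMeasurable (fun ω => u ^ M t ω) P :=
    ((Measurable.of_discrete (f := fun n : ℕ => u ^ n)).comp hN).aestronglyMeasurable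
  have hnn : 0 ≤ᵐ[P] fun ω => u ^ M t ω := ae_of_all _ fun ω => by positivity
  refine ⟨⟨hmeas, ?_⟩, ?_⟩
  · rw [hasFiniteIntegral_iff_ofReal hnn, h3]
    exact ENNReal.ofReal_lt_top
  · rw [integral_eq_lintegral_of_nonneg_ae hnn hmeas, h3,
      ENNReal.toReal_ofReal (Real.exp_pos _).le]

end GeneratingFunction

/-! ### Factorial moments of the Skellam difference at fixed times -/

section FactorialMoments

/-- The Taylor coefficients at `x = 0` of the exponent of `x ↦ 𝔼 ((1 + x) ^ S(1))`. -/
noncomputable def exponentCoeff (k : ℕ) (lam mu : ℕ → ℝ) (m : ℕ) : ℝ :=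
  if m = 0 then 0 else 1 / (m.factorial : ℝ) * ∑ j ∈ Finset.Icc 1 k,
    ((j.descFactorial m : ℝ) * lam j + (-1 : ℝ) ^ m * (j.ascFactorial m : ℝ) * mu j)

/-- The coefficient of `yⁿ / n!` in `𝔼 (choose (S(y)) r)`. -/
noncomputable def momentCoeff (k : ℕ) (lam mu : ℕ → ℝ) (n r : ℕ) : ℝ :=
  ∑ m ∈ posTuples n r, ∏ l : Fin n, exponentCoeff k lam mu (m l)

theorem hasSum_choose_sub_one (s : ℤ) {x : ℝ} (hx : |x| < 1) :
    HasSum (fun m => if m = 0 then 0 else Ring.choose (s : ℝ) m * x ^ m) ((1 + x) ^ s - 1) := by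
  have h := (hasSum_choose_mul_pow s hx).sub (hasSum_ite_eq 0 (1 : ℝ))
  refine h.congr_fun fun m => ?_
  split_ifs with hm
  · simp [hm]
  · simp

theorem hasSum_exponentCoeff (k : ℕ) (lam mu : ℕ → ℝ) {x : ℝ} (hx : |x| < 1) :
    HasSum (fun m => exponentCoeff k lam mu m * x ^ m)
      (jumpExponent k lam (1 + x) + jumpExponent k mu (1 + x)⁻¹) := by
  rw [jumpExponent_real, jumpExponent_real, ← Finset.sum_add_distrib]
  have h := hasSum_sum (s := Finset.Icc 1 k) fun j _ =>
    ((hasSum_choose_sub_one (j : ℤ) hx).mul_left (lam j)).add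
      ((hasSum_choose_sub_one (-(j : ℤ)) hx).mul_left (mu j))
  simp only [zpow_natCast, zpow_neg, ← inv_pow] at h
  refine h.congr_fun fun m => ?_
  rw [exponentCoeff]
  split_ifs with hm
  · simp
  · rw [Finset.mul_sum, Finset.sum_mul]
    refine Finset.sum_congr rfl fun j _ => ?_
    push_cast
    rw [choose_natCast_eq, choose_neg_natCast_eq]
    ring

variable {Ω : Type*} [MeasurableSpace Ω] {P : Measure Ω}

theorem measurable_gsp {M₁ M₂ : ℝ≥0 → Ω → ℕ} {k : ℕ} {lam mu : ℕ → ℝ}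
    (hM₁ : IsGCP k lam M₁ P) (hM₂ : IsGCP k mu M₂ P) (y : ℝ≥0) : Measurable (gsp M₁ M₂ y) := by
  have h1 := measurable_of_levy_natCast hM₁.levy y
  have h2 := measurable_of_levy_natCast hM₂.levy y
  unfold gsp
  fun_prop

theorem measurable_comp_gsp {M₁ M₂ : ℝ≥0 → Ω → ℕ} {k : ℕ} {lam mu : ℕ → ℝ}
    (hM₁ : IsGCP k lam M₁ P) (hM₂ : IsGCP k mu M₂ P) (y : ℝ≥0) (g : ℤ → ℝ) :
    Measurable fun ω => g (gsp M₁ M₂ y ω) :=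
  (Measurable.of_discrete (f := g)).comp (measurable_gsp hM₁ hM₂ y)

theorem integral_zpow_gsp [IsProbabilityMeasure P] {M₁ M₂ : ℝ≥0 → Ω → ℕ} {k : ℕ}
    {lam mu : ℕ → ℝ} (hM₁ : IsGCP k lam M₁ P) (hM₂ : IsGCP k mu M₂ P)
    (hM : IndepFun (fun ω t => M₁ t ω) (fun ω t => M₂ t ω) P) {u : ℝ} (hu : 0 < u) (y : ℝ≥0) :
    ∫ ω, u ^ gsp M₁ M₂ y ω ∂P =
      Real.exp (y * (jumpExponent k lam u + jumpExponent k mu u⁻¹)) := by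
  have hind := (hM.comp (measurable_pi_apply y) (measurable_pi_apply y)).comp
    (Measurable.of_discrete (f := fun n : ℕ => u ^ n))
    (Measurable.of_discrete (f := fun n : ℕ => u⁻¹ ^ n))
  have h1 := hM₁.integral_pow hu.le y
  have h2 := hM₂.integral_pow (inv_pos.mpr hu).le y
  have h3 := hind.integral_fun_mul_eq_mul_integral h1.1.aestronglyMeasurable
    h2.1.aestronglyMeasurable
  simp only [Function.comp_apply] at h3
  rw [h1.2, h2.2, ← Real.exp_add, ← mul_add] at h3
  rw [← h3]
  refine integral_congr_ae (ae_of_all _ fun ω => ?_)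
  simp only [gsp]
  rw [zpow_sub₀ hu.ne', zpow_natCast, zpow_natCast, inv_pow, div_eq_mul_inv]

theorem integrable_pow_natAbs_gsp [IsProbabilityMeasure P] {M₁ M₂ : ℝ≥0 → Ω → ℕ} {k : ℕ}
    {lam mu : ℕ → ℝ} (hM₁ : IsGCP k lam M₁ P) (hM₂ : IsGCP k mu M₂ P)
    (hM : IndepFun (fun ω t => M₁ t ω) (fun ω t => M₂ t ω) P) {u : ℝ} (hu : 1 ≤ u) (y : ℝ≥0) :
    Integrable (fun ω => u ^ (gsp M₁ M₂ y ω).natAbs) P := by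
  have hu0 : 0 ≤ u := by linarith
  have hind := (hM.comp (measurable_pi_apply y) (measurable_pi_apply y)).comp
    (Measurable.of_discrete (f := fun n : ℕ => u ^ n))
    (Measurable.of_discrete (f := fun n : ℕ => u ^ n))
  have h3 := hind.integrable_mul (hM₁.integral_pow hu0 y).1 (hM₂.integral_pow hu0 y).1
  refine h3.mono (measurable_comp_gsp hM₁ hM₂ y fun s => u ^ s.natAbs).aestronglyMeasurable
    (ae_of_all _ fun ω => ?_)
  simp only [Pi.mul_apply, Function.comp_apply]
  rw [← pow_add, Real.norm_of_nonneg (by positivity), Real.norm_of_nonneg (by positivity)]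
  refine pow_le_pow_right₀ hu ?_
  simp only [gsp]
  omega

theorem integrable_choose_gsp_and_hasSum [IsProbabilityMeasure P] {M₁ M₂ : ℝ≥0 → Ω → ℕ} {k : ℕ}
    {lam mu : ℕ → ℝ} (hM₁ : IsGCP k lam M₁ P) (hM₂ : IsGCP k mu M₂ P)
    (hM : IndepFun (fun ω t => M₁ t ω) (fun ω t => M₂ t ω) P) (y : ℝ≥0) {x : ℝ} (hx : |x| < 1) :
    (∀ r, Integrable (fun ω => Ring.choose ((gsp M₁ M₂ y ω : ℤ) : ℝ) r * x ^ r) P) ∧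
    HasSum (fun r => (∫ ω, Ring.choose ((gsp M₁ M₂ y ω : ℤ) : ℝ) r ∂P) * x ^ r)
      (Real.exp (y * (jumpExponent k lam (1 + x) + jumpExponent k mu (1 + x)⁻¹))) := by
  have hx' := abs_lt.mp hx
  have hu : 1 ≤ (1 - |x|)⁻¹ := by
    rw [one_le_inv₀ (by linarith)]
    linarith [abs_nonneg x]
  have hB := integrable_pow_natAbs_gsp hM₁ hM₂ hM hu y
  have hF : ∀ r, Integrable (fun ω => Ring.choose ((gsp M₁ M₂ y ω : ℤ) : ℝ) r * x ^ r) P := by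
    intro r
    refine hB.mono' (measurable_comp_gsp hM₁ hM₂ y
      fun s => Ring.choose (s : ℝ) r * x ^ r).aestronglyMeasurable (ae_of_all _ fun ω => ?_)
    have h := hasSum_abs_choose_mul_pow_le (gsp M₁ M₂ y ω) hx
    exact (h.1.le_tsum r fun _ _ => abs_nonneg _).trans h.2
  refine ⟨hF, ?_⟩
  have hsum : Summable fun r =>
      ∫ ω, ‖Ring.choose ((gsp M₁ M₂ y ω : ℤ) : ℝ) r * x ^ r‖ ∂P := by
    refine summable_of_sum_range_le (c := ∫ ω, (1 - |x|)⁻¹ ^ (gsp M₁ M₂ y ω).natAbs ∂P)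
      (fun r => integral_nonneg fun _ => norm_nonneg _) fun n => ?_
    rw [← integral_finsetSum _ fun r _ => (hF r).norm]
    refine integral_mono (integrable_finsetSum _ fun r _ => (hF r).norm) hB fun ω => ?_
    have h := hasSum_abs_choose_mul_pow_le (gsp M₁ M₂ y ω) hx
    exact (h.1.sum_le_tsum _ fun _ _ => abs_nonneg _).trans h.2
  have h := hasSum_integral_of_summable_integral_norm hF hsum
  rw [← integral_zpow_gsp hM₁ hM₂ hM (by linarith) y]
  simp only [integral_mul_const] at h
  rwa [integral_congr_ae (ae_of_all _ fun ω => (hasSum_choose_mul_pow (gsp M₁ M₂ y ω) hx).tsum_eq)]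
    at h

theorem integrable_choose_gsp [IsProbabilityMeasure P] {M₁ M₂ : ℝ≥0 → Ω → ℕ} {k : ℕ}
    {lam mu : ℕ → ℝ} (hM₁ : IsGCP k lam M₁ P) (hM₂ : IsGCP k mu M₂ P)
    (hM : IndepFun (fun ω t => M₁ t ω) (fun ω t => M₂ t ω) P) (y : ℝ≥0) (r : ℕ) :
    Integrable (fun ω => Ring.choose ((gsp M₁ M₂ y ω : ℤ) : ℝ) r) P := by
  have h := (integrable_choose_gsp_and_hasSum hM₁ hM₂ hM y (x := 1 / 2)
    (by rw [abs_of_pos] <;> norm_num)).1 r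
  simpa using h.mul_const (2 ^ r)

/-- Both sides are the coefficients of one function of `x` on `|x| < 1`: exchanging sum and
expectation gives one expansion, expanding `exp (y φ(x))` the other. -/
theorem integral_choose_gsp [IsProbabilityMeasure P] {M₁ M₂ : ℝ≥0 → Ω → ℕ} {k : ℕ}
    {lam mu : ℕ → ℝ} (hM₁ : IsGCP k lam M₁ P) (hM₂ : IsGCP k mu M₂ P)
    (hM : IndepFun (fun ω t => M₁ t ω) (fun ω t => M₂ t ω) P) (y : ℝ≥0) (r : ℕ) :
    ∫ ω, Ring.choose ((gsp M₁ M₂ y ω : ℤ) : ℝ) r ∂P =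
      ∑ n ∈ Finset.range (r + 1), (y : ℝ) ^ n / (n.factorial : ℝ) * momentCoeff k lam mu n r := by
  refine congrFun (coeff_unique_of_hasSum one_pos
    (fun x hx => (integrable_choose_gsp_and_hasSum hM₁ hM₂ hM y hx).2)
    (fun x hx => hasSum_exp_powerSeries (by simp [exponentCoeff])
      (hasSum_exponentCoeff k lam mu hx) y)) r

theorem descPochhammer_eval_intCast (s : ℤ) (r : ℕ) :
    (((descPochhammer ℤ r).eval s : ℤ) : ℝ) = (r.factorial : ℝ) * Ring.choose (s : ℝ) r := by
  have h := Ring.descPochhammer_eq_factorial_smul_choose s r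
  rw [nsmul_eq_mul, ← Polynomial.eval_eq_smeval] at h
  rw [h]
  push_cast
  congr 1
  exact Ring.map_choose (Int.castRingHom ℝ) s r

/-- By `(X)_r * X = (X)_{r+1} + r (X)_r`, the span is stable under multiplication by `X`, and it
contains `1`. -/
theorem mem_span_descPochhammer (f : Polynomial ℝ) :
    f ∈ Submodule.span ℝ (Set.range fun r : ℕ => descPochhammer ℝ r) := by
  have hX : ∀ g ∈ Submodule.span ℝ (Set.range fun r : ℕ => descPochhammer ℝ r),
      g * Polynomial.X ∈ Submodule.span ℝ (Set.range fun r : ℕ => descPochhammer ℝ r) := by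
    intro g hg
    induction hg using Submodule.span_induction with
    | mem g hg =>
      obtain ⟨r, rfl⟩ := hg
      have : descPochhammer ℝ r * Polynomial.X =
          descPochhammer ℝ (r + 1) + (r : ℝ) • descPochhammer ℝ r := by
        rw [descPochhammer_succ_right, Polynomial.smul_eq_C_mul, Polynomial.C_eq_natCast]
        ring
      simp only [this]
      exact Submodule.add_mem _ (Submodule.subset_span ⟨r + 1, rfl⟩)
        (Submodule.smul_mem _ _ (Submodule.subset_span ⟨r, rfl⟩))
    | zero => simp
    | add a b _ _ ha hb => rw [add_mul]; exact Submodule.add_mem _ ha hb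
    | smul c a _ ha => rw [smul_mul_assoc]; exact Submodule.smul_mem _ _ ha
  have hpow : ∀ n : ℕ, (Polynomial.X : Polynomial ℝ) ^ n ∈
      Submodule.span ℝ (Set.range fun r : ℕ => descPochhammer ℝ r) := by
    intro n
    induction n with
    | zero => exact Submodule.subset_span ⟨0, by simp⟩
    | succ n ih => rw [pow_succ]; exact hX _ ih
  rw [f.as_sum_range_C_mul_X_pow]
  refine Submodule.sum_mem _ fun n _ => ?_
  rw [← Polynomial.smul_eq_C_mul]
  exact Submodule.smul_mem _ _ (hpow n)

/-- The `r`-th factorial moment of `S(y)`, as a polynomial in `y`. -/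
noncomputable def momentPolynomial (k : ℕ) (lam mu : ℕ → ℝ) (r : ℕ) : Polynomial ℝ :=
  ∑ n ∈ Finset.range (r + 1),
    Polynomial.monomial n ((r.factorial : ℝ) * ((n.factorial : ℝ)⁻¹ * momentCoeff k lam mu n r))

theorem momentPolynomial_natDegree_lt (k : ℕ) (lam mu : ℕ → ℝ) (r : ℕ) :
    (momentPolynomial k lam mu r).natDegree < r + 1 := by
  refine Nat.lt_succ_of_le (Polynomial.natDegree_sum_le_of_forall_le _ _ fun n hn => ?_)
  exact (Polynomial.natDegree_monomial_le _).trans (Nat.lt_succ_iff.mp (Finset.mem_range.mp hn))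

theorem momentPolynomial_coeff (k : ℕ) (lam mu : ℕ → ℝ) {n r : ℕ} (hn : n ∈ Finset.range (r + 1)) :
    (momentPolynomial k lam mu r).coeff n =
      (r.factorial : ℝ) * ((n.factorial : ℝ)⁻¹ * momentCoeff k lam mu n r) := by
  rw [momentPolynomial, Polynomial.finsetSum_coeff]
  simp only [Polynomial.coeff_monomial]
  rw [Finset.sum_ite_eq', if_pos hn]

theorem descPochhammer_eval_eq_choose (s : ℤ) (r : ℕ) :
    (descPochhammer ℝ r).eval (s : ℝ) = (r.factorial : ℝ) * Ring.choose (s : ℝ) r := by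
  rw [← descPochhammer_eval_intCast, descPochhammer_eval_cast]

theorem integral_descPochhammer_gsp [IsProbabilityMeasure P] {M₁ M₂ : ℝ≥0 → Ω → ℕ}
    {k : ℕ} {lam mu : ℕ → ℝ} (hM₁ : IsGCP k lam M₁ P) (hM₂ : IsGCP k mu M₂ P)
    (hM : IndepFun (fun ω t => M₁ t ω) (fun ω t => M₂ t ω) P) (r : ℕ) (y : ℝ≥0) :
    ∫ ω, (descPochhammer ℝ r).eval ((gsp M₁ M₂ y ω : ℤ) : ℝ) ∂P =
      (momentPolynomial k lam mu r).eval (y : ℝ) := by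
  simp only [descPochhammer_eval_eq_choose]
  rw [integral_const_mul, integral_choose_gsp hM₁ hM₂ hM, momentPolynomial,
    Polynomial.eval_finsetSum, Finset.mul_sum]
  refine Finset.sum_congr rfl fun n _ => ?_
  rw [Polynomial.eval_monomial]
  ring

/-- Polynomial moments of `S(y)` are polynomials in `y`. -/
theorem exists_polynomial_integral_eval_gsp [IsProbabilityMeasure P] {M₁ M₂ : ℝ≥0 → Ω → ℕ}
    {k : ℕ} {lam mu : ℕ → ℝ} (hM₁ : IsGCP k lam M₁ P) (hM₂ : IsGCP k mu M₂ P)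
    (hM : IndepFun (fun ω t => M₁ t ω) (fun ω t => M₂ t ω) P) (f : Polynomial ℝ) :
    (∀ y, Integrable (fun ω => f.eval ((gsp M₁ M₂ y ω : ℤ) : ℝ)) P) ∧
    ∃ q : Polynomial ℝ, ∀ y : ℝ≥0,
      ∫ ω, f.eval ((gsp M₁ M₂ y ω : ℤ) : ℝ) ∂P = q.eval (y : ℝ) := by
  induction mem_span_descPochhammer f using Submodule.span_induction with
  | mem g hg =>
    obtain ⟨r, rfl⟩ := hg
    refine ⟨fun y => ?_, _, fun y => integral_descPochhammer_gsp hM₁ hM₂ hM r y⟩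
    simp only [descPochhammer_eval_eq_choose]
    exact (integrable_choose_gsp hM₁ hM₂ hM y r).const_mul _
  | zero => exact ⟨fun y => by simp, 0, fun y => by simp⟩
  | add a b _ _ ha hb =>
    obtain ⟨ha, qa, hqa⟩ := ha
    obtain ⟨hb, qb, hqb⟩ := hb
    simp only [Polynomial.eval_add]
    exact ⟨fun y => (ha y).add (hb y), qa + qb, fun y => by
      rw [integral_add (ha y) (hb y), hqa, hqb, Polynomial.eval_add]⟩
  | smul c a _ ha =>
    obtain ⟨ha, qa, hqa⟩ := ha
    simp only [Polynomial.eval_smul, smul_eq_mul]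
    exact ⟨fun y => (ha y).const_mul c, c • qa, fun y => by
      rw [integral_const_mul, hqa, Polynomial.eval_smul, smul_eq_mul]⟩

end FactorialMoments

/-! ### Evaluation at an independent random time -/

section RandomTime

/-- The point of the grid `(n + 1)⁻¹ ℕ` immediately to the right of `y`. -/
noncomputable def gridRight (n : ℕ) (y : ℝ≥0) : ℝ≥0 := ((⌊y * (n + 1)⌋₊ : ℝ≥0) + 1) / (n + 1)

theorem tendsto_gridRight (y : ℝ≥0) : Tendsto (fun n => gridRight n y) atTop (𝓝[≥] y) := by
  have h1 : ∀ n, y ≤ gridRight n y := fun n => by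
    rw [gridRight, le_div_iff₀ (by positivity)]
    exact (Nat.lt_floor_add_one _).le
  have h2 : ∀ n, gridRight n y ≤ y + 1 / ((n : ℝ≥0) + 1) := fun n => by
    rw [gridRight, div_le_iff₀ (by positivity), add_mul, one_div_mul_cancel (by positivity)]
    gcongr
    exact Nat.floor_le (by positivity)
  have h3 : Tendsto (fun n : ℕ => y + 1 / ((n : ℝ≥0) + 1)) atTop (𝓝 y) := by
    rw [← NNReal.tendsto_coe]
    push_cast
    simpa using (tendsto_one_div_add_atTop_nhds_zero_nat (𝕜 := ℝ)).const_add (y : ℝ)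
  exact tendsto_nhdsWithin_iff.mpr
    ⟨tendsto_of_tendsto_of_tendsto_of_le_of_le tendsto_const_nhds h3 h1 h2,
      Eventually.of_forall h1⟩

variable {Ω : Type*} [MeasurableSpace Ω] {P : Measure Ω}

/-- Evaluating a whole path at a variable time is not measurable for the product σ-algebra. Keeping
only a countable grid of coordinates avoids this, and right-continuity recovers the path from the
grid. -/
theorem aemeasurable_gridPath {X : ℝ≥0 → Ω → ℤ} (hX : ∀ t, AEMeasurable (X t) P) :
    AEMeasurable (fun ω (p : ℕ × ℕ) => X (((p.2 : ℝ≥0) + 1) / (p.1 + 1)) ω) P :=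
  aemeasurable_pi_iff.mpr fun _ => hX _

theorem measurable_eval_gridPath (n : ℕ) :
    Measurable fun p : ℝ≥0 × (ℕ × ℕ → ℤ) => p.2 (n, ⌊p.1 * (n + 1)⌋₊) := by
  have h1 : Measurable fun p : (ℕ × ℕ → ℤ) × ℕ => p.1 (n, p.2) :=
    measurable_from_prod_countable_left fun i => measurable_pi_apply (n, i)
  exact h1.comp (measurable_snd.prodMk
    (Nat.measurable_floor.comp (measurable_fst.mul_const _)))

theorem aemeasurable_comp_randomTime {X : ℝ≥0 → Ω → ℤ} {T : Ω → ℝ≥0}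
    (hX : ∀ t, AEMeasurable (X t) P)
    (hrc : ∀ᵐ ω ∂P, ∀ t, ContinuousWithinAt (fun s => X s ω) (Set.Ici t) t)
    (hT : AEMeasurable T P) : AEMeasurable (fun ω => X (T ω) ω) P := by
  refine aemeasurable_of_tendsto_metrizable_ae atTop
    (f := fun n ω => X (gridRight n (T ω)) ω) (fun n => ?_) ?_
  · exact (measurable_eval_gridPath n).comp_aemeasurable (hT.prodMk (aemeasurable_gridPath hX))
  · filter_upwards [hrc] with ω hω
    exact (hω (T ω)).tendsto.comp (tendsto_gridRight _)

/-- Evaluation of a right-continuous process at an independent random time: the expectation is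
obtained by averaging the expectations at deterministic times. -/
theorem integral_comp_randomTime [IsProbabilityMeasure P] {X : ℝ≥0 → Ω → ℤ} {T : Ω → ℝ≥0}
    (hX : ∀ t, AEMeasurable (X t) P)
    (hrc : ∀ᵐ ω ∂P, ∀ t, ContinuousWithinAt (fun s => X s ω) (Set.Ici t) t)
    (hT : AEMeasurable T P) (hind : IndepFun (fun ω t => X t ω) T P) {g : ℤ → ℝ} {B m : ℝ≥0 → ℝ}
    (hg : ∀ y, Integrable (fun ω => g (X y ω)) P) (hBm : Measurable B)
    (hB : ∀ y, ∫ ω, |g (X y ω)| ∂P ≤ B y) (hBT : Integrable (fun ω => B (T ω)) P)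
    (hmm : Measurable m) (hm : ∀ y, ∫ ω, g (X y ω) ∂P = m y) :
    Integrable (fun ω => g (X (T ω) ω)) P ∧ ∫ ω, g (X (T ω) ω) ∂P = ∫ ω, m (T ω) ∂P := by
  set W : Ω → ℕ × ℕ → ℤ := fun ω p => X (((p.2 : ℝ≥0) + 1) / (p.1 + 1)) ω with hWdef
  have hW : AEMeasurable W P := aemeasurable_gridPath hX
  have hindW : IndepFun T W P := by
    have hres : Measurable fun (x : ℝ≥0 → ℤ) (p : ℕ × ℕ) => x (((p.2 : ℝ≥0) + 1) / (p.1 + 1)) :=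
      measurable_pi_lambda _ fun p => measurable_pi_apply _
    exact (hind.comp hres measurable_id).symm
  have hTW : AEMeasurable (fun ω => (T ω, W ω)) P := hT.prodMk hW
  have hlaw := hindW.map_prod_eq_prod_map_map hT hW
  have hPT : IsProbabilityMeasure (P.map T) := Measure.isProbabilityMeasure_map hT
  have hPW : IsProbabilityMeasure (P.map W) := Measure.isProbabilityMeasure_map hW
  have hΨn := measurable_eval_gridPath
  -- The grid values converge a.s. under the joint law of time and grid. The measurable limit `Ψ`
  -- represents `X (T ω) ω`, and Fubini applies to it since the joint law is a product.
  have hlim : ∀ᵐ p ∂(P.map fun ω => (T ω, W ω)),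
      ∃ l : ℤ, Tendsto (fun n : ℕ => p.2 (n, ⌊p.1 * (n + 1)⌋₊)) atTop (𝓝 l) := by
    rw [ae_map_iff hTW (measurableSet_exists_tendsto hΨn)]
    filter_upwards [hrc] with ω hω
    exact ⟨_, (hω (T ω)).tendsto.comp (tendsto_gridRight _)⟩
  obtain ⟨Ψ, hΨ, hΨlim⟩ := measurable_limit_of_tendsto_metrizable_ae
    (fun n => (hΨn n).aemeasurable) hlim
  have hae : (fun ω => Ψ (T ω, W ω)) =ᵐ[P] fun ω => X (T ω) ω := by
    filter_upwards [hrc, ae_of_ae_map hTW hΨlim] with ω hω h1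
    exact tendsto_nhds_unique h1 ((hω (T ω)).tendsto.comp (tendsto_gridRight _))
  rw [hlaw] at hΨlim
  -- Freezing the time in the product law identifies almost every section of `Ψ` with `X y`.
  have hfib : ∀ᵐ y ∂(P.map T), (fun ω => Ψ (y, W ω)) =ᵐ[P] fun ω => X y ω := by
    filter_upwards [Measure.ae_ae_of_ae_prod hΨlim] with y hy
    filter_upwards [hrc, ae_of_ae_map hW hy] with ω hω h1
    exact tendsto_nhds_unique h1 ((hω y).tendsto.comp (tendsto_gridRight _))
  have hgΨ : Measurable fun p => g (Ψ p) := (Measurable.of_discrete (f := g)).comp hΨ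
  have hgy : ∀ y, Measurable fun w => g (Ψ (y, w)) := fun y => hgΨ.comp measurable_prodMk_left
  have hint : Integrable (fun p => g (Ψ p)) ((P.map T).prod (P.map W)) := by
    rw [integrable_prod_iff hgΨ.aestronglyMeasurable]
    constructor
    · filter_upwards [hfib] with y hy
      rw [integrable_map_measure (hgy y).aestronglyMeasurable hW]
      refine (hg y).congr ?_
      filter_upwards [hy] with ω hω
      simp [hω]
    · refine Integrable.mono' ((integrable_map_measure hBm.aestronglyMeasurable hT).mpr hBT)
        hgΨ.norm.stronglyMeasurable.integral_prod_right'.aestronglyMeasurable ?_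
      filter_upwards [hfib] with y hy
      rw [Real.norm_of_nonneg (integral_nonneg fun _ => norm_nonneg _),
        integral_map hW (hgy y).norm.aestronglyMeasurable]
      refine le_trans (le_of_eq (integral_congr_ae ?_)) (hB y)
      filter_upwards [hy] with ω hω
      simp [hω]
  have hint' : Integrable (fun ω => g (Ψ (T ω, W ω))) P := by
    rw [← hlaw, integrable_map_measure hgΨ.aestronglyMeasurable hTW] at hint
    exact hint
  have hae' : (fun ω => g (Ψ (T ω, W ω))) =ᵐ[P] fun ω => g (X (T ω) ω) := by
    filter_upwards [hae] with ω hω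
    rw [hω]
  refine ⟨hint'.congr hae', ?_⟩
  rw [← integral_congr_ae hae', ← integral_map hTW (f := fun p => g (Ψ p))
    hgΨ.aestronglyMeasurable, hlaw, integral_prod _ hint,
    ← integral_map hT hmm.aestronglyMeasurable]
  refine integral_congr_ae ?_
  filter_upwards [hfib] with y hy
  rw [integral_map hW (hgy y).aestronglyMeasurable, ← hm y]
  refine integral_congr_ae ?_
  filter_upwards [hy] with ω hω
  rw [hω]

end RandomTime

/-! ### Laplace transforms determine laws on the half-line -/

section LaplaceUniqueness

theorem mgf_eq_tsum_moments {μ : Measure ℝ} [IsProbabilityMeasure μ]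
    (h : ∀ᵐ w ∂μ, w ∈ Set.Icc (0 : ℝ) 1) (t : ℝ) :
    mgf id μ t = ∑' n : ℕ, t ^ n / (n.factorial : ℝ) * ∫ w, w ^ n ∂μ := by
  have hI : ∀ n : ℕ, Integrable (fun w : ℝ => w ^ n) μ := fun n => by
    refine Integrable.of_bound (C := 1) (by fun_prop) ?_
    filter_upwards [h] with w hw
    rw [norm_pow, Real.norm_of_nonneg hw.1]
    exact pow_le_one₀ hw.1 hw.2
  have h1 : ∀ w : ℝ, Real.exp (t * w) = ∑' n : ℕ, t ^ n / (n.factorial : ℝ) * w ^ n := by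
    intro w
    rw [Real.exp_eq_exp_ℝ, ← (NormedSpace.expSeries_div_hasSum_exp (t * w)).tsum_eq]
    simp only [mul_pow, mul_div_right_comm]
  rw [mgf]
  simp only [id, h1, ← integral_const_mul]
  refine (integral_tsum_of_summable_integral_norm (fun n => (hI n).const_mul _) ?_).symm
  refine Summable.of_nonneg_of_le (fun n => integral_nonneg fun _ => norm_nonneg _) (fun n => ?_)
    (Real.summable_pow_div_factorial |t|)
  have h2 : ∫ w, ‖t ^ n / (n.factorial : ℝ) * w ^ n‖ ∂μ ≤ ∫ _w, |t| ^ n / (n.factorial : ℝ) ∂μ := by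
    refine integral_mono_ae ((hI n).const_mul _).norm (integrable_const _) ?_
    filter_upwards [h] with w hw
    rw [norm_mul, norm_div, norm_pow, norm_pow, Real.norm_of_nonneg hw.1, Real.norm_natCast,
      Real.norm_eq_abs]
    exact mul_le_of_le_one_right (by positivity) (pow_le_one₀ hw.1 hw.2)
  simpa using h2

theorem measure_eq_of_moments_eq {μ ν : Measure ℝ} [IsProbabilityMeasure μ]
    [IsProbabilityMeasure ν] (hμ : ∀ᵐ w ∂μ, w ∈ Set.Icc (0 : ℝ) 1)
    (hν : ∀ᵐ w ∂ν, w ∈ Set.Icc (0 : ℝ) 1)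
    (h : ∀ n : ℕ, ∫ w, w ^ n ∂μ = ∫ w, w ^ n ∂ν) : μ = ν := by
  have hmgf : mgf id μ = mgf id ν := by
    ext t
    rw [mgf_eq_tsum_moments hμ, mgf_eq_tsum_moments hν]
    simp only [h]
  have hexp : integrableExpSet id μ = Set.univ := by
    ext t
    simp only [integrableExpSet, Set.mem_univ, iff_true, Set.mem_ofPred_eq]
    refine Integrable.of_bound (C := Real.exp |t|) (by fun_prop) ?_
    filter_upwards [hμ] with w hw
    rw [Real.norm_of_nonneg (Real.exp_pos _).le, Real.exp_le_exp]
    calc t * id w ≤ |t| * w := mul_le_mul_of_nonneg_right (le_abs_self t) hw.1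
      _ ≤ |t| := mul_le_of_le_one_right (abs_nonneg _) hw.2
  refine Measure.ext_of_complexMGF_id_eq (funext fun z => ?_)
  exact eqOn_complexMGF_of_mgf hmgf (by simp [hexp])

/-- The variable `exp (-U)` lives in `[0, 1]`, and its `n`-th moment is the Laplace transform of `U`
at `n`. Moments determine a law on `[0, 1]`, and `-log` carries it back. -/
theorem map_eq_of_laplace_eq {Ω : Type*} [MeasurableSpace Ω] {P : Measure Ω}
    [IsProbabilityMeasure P] {U V : Ω → ℝ} (hU : Measurable U) (hV : Measurable V)
    (hU0 : ∀ ω, 0 ≤ U ω) (hV0 : ∀ ω, 0 ≤ V ω)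
    (h : ∀ s : ℝ, 0 < s → ∫ ω, Real.exp (-s * U ω) ∂P = ∫ ω, Real.exp (-s * V ω) ∂P) :
    P.map U = P.map V := by
  have hexp : Measurable fun x : ℝ => Real.exp (-x) := by fun_prop
  have hcomp : ∀ {Z : Ω → ℝ}, Measurable Z → Measurable fun ω => Real.exp (-Z ω) :=
    fun hZ => hexp.comp hZ
  have hprob : ∀ {Z : Ω → ℝ}, Measurable Z → IsProbabilityMeasure (P.map fun ω => Real.exp (-Z ω)) :=
    fun hZ => Measure.isProbabilityMeasure_map (hcomp hZ).aemeasurable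
  have hmem : ∀ {Z : Ω → ℝ}, Measurable Z → (∀ ω, 0 ≤ Z ω) →
      ∀ᵐ w ∂(P.map fun ω => Real.exp (-Z ω)), w ∈ Set.Icc (0 : ℝ) 1 := by
    intro Z hZ hZ0
    refine (ae_map_iff (p := fun w => w ∈ Set.Icc (0 : ℝ) 1) (hcomp hZ).aemeasurable
      measurableSet_Icc).mpr ?_
    exact ae_of_all _ fun ω => ⟨(Real.exp_pos _).le, Real.exp_le_one_iff.mpr (by linarith [hZ0 ω])⟩
  have hmom : ∀ {Z : Ω → ℝ}, Measurable Z → ∀ n : ℕ,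
      ∫ w, w ^ n ∂(P.map fun ω => Real.exp (-Z ω)) = ∫ ω, Real.exp (-(n : ℝ) * Z ω) ∂P := by
    intro Z hZ n
    rw [integral_map (hcomp hZ).aemeasurable (by fun_prop)]
    refine integral_congr_ae (ae_of_all _ fun ω => ?_)
    simp only
    rw [← Real.exp_nat_mul]
    ring_nf
  have := hprob hU
  have := hprob hV
  have hkey : (P.map fun ω => Real.exp (-U ω)) = P.map fun ω => Real.exp (-V ω) := by
    refine measure_eq_of_moments_eq (hmem hU hU0) (hmem hV hV0) fun n => ?_
    rw [hmom hU, hmom hV]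
    rcases Nat.eq_zero_or_pos n with rfl | hn
    · simp
    · exact h n (by exact_mod_cast hn)
  have hlog : Measurable fun w : ℝ => -Real.log w := by fun_prop
  have hback : ∀ {Z : Ω → ℝ}, Measurable Z →
      (P.map fun ω => Real.exp (-Z ω)).map (fun w => -Real.log w) = P.map Z := by
    intro Z hZ
    rw [Measure.map_map hlog (hcomp hZ)]
    congr 1
    ext ω
    simp
  rw [← hback hU, hkey, hback hV]

end LaplaceUniqueness

/-! ### Paths of the first passage time -/

section FirstPassage

theorem firstPassage_le {Ω : Type*} {D : ℝ≥0 → Ω → ℝ≥0} {ω : Ω} {d x : ℝ≥0} (h : d < D x ω) :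
    firstPassage D d ω ≤ x :=
  csInf_le (OrderBot.bddBelow _) h

/-- Unboundedness keeps the defining set nonempty; for the empty set `sInf` would return `0`. -/
theorem lt_of_firstPassage_lt {Ω : Type*} {D : ℝ≥0 → Ω → ℝ≥0} {ω : Ω} (hmono : Monotone fun t => D t ω)
    (hunb : ∀ d : ℝ≥0, ∃ x, d < D x ω) {d x : ℝ≥0} (h : firstPassage D d ω < x) : d < D x ω := by
  obtain ⟨y, hy, hyx⟩ := exists_lt_of_csInf_lt (hunb d) h
  exact lt_of_lt_of_le hy (hmono hyx.le)

theorem firstPassage_monotone {Ω : Type*} {D : ℝ≥0 → Ω → ℝ≥0} {ω : Ω} (hunb : ∀ d : ℝ≥0, ∃ x, d < D x ω) :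
    Monotone fun d => firstPassage D d ω := by
  intro d d' hdd
  exact csInf_le_csInf (OrderBot.bddBelow _) (hunb d') fun x hx => lt_of_le_of_lt hdd hx

theorem firstPassage_continuousWithinAt {Ω : Type*} {D : ℝ≥0 → Ω → ℝ≥0} {ω : Ω}
    (hmono : Monotone fun t => D t ω) (hunb : ∀ d : ℝ≥0, ∃ x, d < D x ω) (d : ℝ≥0) :
    ContinuousWithinAt (fun d => firstPassage D d ω) (Set.Ici d) d := by
  rw [ContinuousWithinAt, tendsto_order]
  constructor
  · intro a ha
    filter_upwards [self_mem_nhdsWithin] with d' hd'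
    exact lt_of_lt_of_le ha (firstPassage_monotone hunb hd')
  · intro b hb
    obtain ⟨x, hx, hxb⟩ := exists_between hb
    have h1 := lt_of_firstPassage_lt hmono hunb hx
    filter_upwards [mem_nhdsWithin_of_mem_nhds (Iio_mem_nhds h1)] with d' hd'
    exact lt_of_le_of_lt (firstPassage_le hd') hxb

end FirstPassage

/-! ### Stable subordinators and moments of their inverses -/

section StableSubordinator

variable {Ω : Type*} [MeasurableSpace Ω] {P : Measure Ω}

theorem IsSubordinator.measurable_coe {D : ℝ≥0 → Ω → ℝ≥0} (hD : IsSubordinator D P) (x : ℝ≥0) :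
    Measurable fun ω => (D x ω : ℝ) := hD.levy.measurable x

theorem IsSubordinator.measurable {D : ℝ≥0 → Ω → ℝ≥0} (hD : IsSubordinator D P) (x : ℝ≥0) :
    Measurable (D x) := by
  have h := (hD.measurable_coe x).real_toNNReal
  simpa only [Real.toNNReal_coe] using h

theorem IsStableSubordinator.lintegral_exp_neg [IsProbabilityMeasure P] {α : ℝ}
    {D : ℝ≥0 → Ω → ℝ≥0} (hD : IsStableSubordinator α D P) (x : ℝ≥0) {s : ℝ} (hs : 0 < s) :
    ∫⁻ ω, ENNReal.ofReal (Real.exp (-s * (D x ω : ℝ))) ∂P =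
      ENNReal.ofReal (Real.exp (-(x : ℝ) * s ^ α)) := by
  have hm := ((hD.subordinator.measurable_coe x).const_mul (-s)).exp
  rw [← hD.laplace x s hs, ofReal_integral_eq_lintegral_ofReal]
  · refine Integrable.of_bound (C := 1) hm.aestronglyMeasurable (ae_of_all _ fun ω => ?_)
    rw [Real.norm_of_nonneg (Real.exp_pos _).le, Real.exp_le_one_iff]
    have : 0 ≤ s * (D x ω : ℝ) := by positivity
    linarith
  · exact ae_of_all _ fun ω => (Real.exp_pos _).le

/-- The paths of a stable subordinator are unbounded. -/
theorem IsStableSubordinator.ae_unbounded [IsProbabilityMeasure P] {α : ℝ}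
    {D : ℝ≥0 → Ω → ℝ≥0} (hD : IsStableSubordinator α D P) :
    ∀ᵐ ω ∂P, ∀ d : ℝ≥0, ∃ x, d < D x ω := by
  have hm : ∀ n : ℕ, AEMeasurable (fun ω => ENNReal.ofReal (Real.exp (-1 * (D n ω : ℝ)))) P :=
    fun n => ((hD.subordinator.measurable_coe n).const_mul (-1)).exp.ennreal_ofReal.aemeasurable
  -- `𝔼 exp (-D(n)) = exp (-n)` is summable, so `exp (-D(n))` tends to `0` a.s.
  have h1 : ∫⁻ ω, ∑' n : ℕ, ENNReal.ofReal (Real.exp (-1 * (D n ω : ℝ))) ∂P ≠ ⊤ := by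
    rw [lintegral_tsum hm]
    simp only [hD.lintegral_exp_neg _ one_pos, Real.one_rpow, mul_one, NNReal.coe_natCast]
    rw [← ENNReal.ofReal_tsum_of_nonneg (fun n => (Real.exp_pos _).le)
      Real.summable_exp_neg_nat]
    exact ENNReal.ofReal_ne_top
  filter_upwards [ae_lt_top' (AEMeasurable.tsum hm) h1]
    with ω hω d
  by_contra! hcon
  have h2 := ENNReal.tendsto_atTop_zero_of_tsum_ne_top hω.ne
  have h3 : ENNReal.ofReal (Real.exp (-1 * (d : ℝ))) ≤ 0 := by
    refine ge_of_tendsto' h2 fun n => ENNReal.ofReal_le_ofReal (Real.exp_le_exp.mpr ?_)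
    have : (D n ω : ℝ) ≤ d := by exact_mod_cast hcon n
    linarith
  rw [nonpos_iff_eq_zero, ENNReal.ofReal_eq_zero] at h3
  exact absurd (Real.exp_pos _) (not_lt.mpr h3)

theorem IsStableSubordinator.aemeasurable_firstPassage [IsProbabilityMeasure P] {α : ℝ}
    {D : ℝ≥0 → Ω → ℝ≥0} (hD : IsStableSubordinator α D P) (d : ℝ≥0) :
    AEMeasurable (firstPassage D d) P := by
  classical
  set g : Ω → ENNReal := fun ω => ⨅ q : ℚ,
    if d < D (Real.toNNReal q) ω then ((Real.toNNReal q : ℝ≥0) : ENNReal) else ⊤ with hg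
  have hgm : Measurable g := by
    refine Measurable.iInf fun q => Measurable.ite ?_ measurable_const measurable_const
    exact measurableSet_lt measurable_const (hD.subordinator.measurable _)
  refine ⟨fun ω => (g ω).toNNReal, hgm.ennreal_toNNReal, ?_⟩
  filter_upwards [hD.subordinator.mono, hD.ae_unbounded] with ω hmono hunb
  have : g ω = (firstPassage D d ω : ENNReal) := by
    refine le_antisymm (le_of_forall_gt fun b hb => ?_) (le_iInf fun q => ?_)
    · obtain ⟨q, _, hq1, hq2⟩ := ENNReal.lt_iff_exists_rat_btwn.mp hb
      refine lt_of_le_of_lt (iInf_le _ q) ?_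
      rw [if_pos (lt_of_firstPassage_lt hmono hunb (by exact_mod_cast hq1))]
      exact hq2
    · split_ifs with h
      · exact_mod_cast firstPassage_le h
      · exact le_top
  simp [this]

/-- `P(D(1) = 0) ≤ 𝔼 exp (-s D(1)) = exp (-s ^ α)`, which tends to `0` as `s → ∞`. -/
theorem IsStableSubordinator.ae_pos [IsProbabilityMeasure P] {α : ℝ} (hα : 0 < α)
    {D : ℝ≥0 → Ω → ℝ≥0} (hD : IsStableSubordinator α D P) : ∀ᵐ ω ∂P, 0 < D 1 ω := by
  have hms : MeasurableSet {ω | D 1 ω = 0} :=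
    hD.subordinator.measurable 1 (measurableSet_singleton 0)
  have h1 : ∀ s : ℝ, 0 < s → P {ω | D 1 ω = 0} ≤ ENNReal.ofReal (Real.exp (-s ^ α)) := by
    intro s hs
    have h2 := hD.lintegral_exp_neg 1 hs
    rw [NNReal.coe_one, neg_mul, one_mul] at h2
    rw [← h2, ← lintegral_indicator_one hms]
    refine lintegral_mono fun ω => ?_
    by_cases hω : D 1 ω = 0
    · simp [hω]
    · simp [hω]
  have h3 : Tendsto (fun s : ℝ => ENNReal.ofReal (Real.exp (-s ^ α))) atTop (𝓝 0) := by
    rw [← ENNReal.ofReal_zero]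
    exact ENNReal.tendsto_ofReal (Real.tendsto_exp_neg_atTop_nhds_zero.comp
      (tendsto_rpow_atTop hα))
  have h4 : P {ω | D 1 ω = 0} ≤ 0 := by
    refine ge_of_tendsto h3 ?_
    filter_upwards [eventually_gt_atTop 0] with s hs using h1 s hs
  rw [ae_iff]
  simpa only [not_lt, nonpos_iff_eq_zero] using h4

/-- Self-similarity of a stable subordinator, at the level of one-dimensional laws. -/
theorem IsStableSubordinator.measure_le_eq [IsProbabilityMeasure P] {α : ℝ} (hα : 0 < α)
    {D : ℝ≥0 → Ω → ℝ≥0} (hD : IsStableSubordinator α D P) {x : ℝ} (hx : 0 < x) (d : ℝ≥0) :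
    P {ω | D x.toNNReal ω ≤ d} = P {ω | x ≤ ((d : ℝ) / (D 1 ω : ℝ)) ^ α} := by
  have hm := fun x => hD.subordinator.measurable_coe x
  -- Both variables have Laplace transform `exp (-x s ^ α)`.
  have hlaw : P.map (fun ω => (D x.toNNReal ω : ℝ)) =
      P.map (fun ω => x ^ α⁻¹ * (D 1 ω : ℝ)) := by
    refine map_eq_of_laplace_eq (hm _) ((hm 1).const_mul _) (fun ω => by positivity)
      (fun ω => by positivity) fun s hs => ?_
    rw [hD.laplace _ s hs, Real.coe_toNNReal _ hx.le]
    have h1 := hD.laplace 1 (s * x ^ α⁻¹) (by positivity)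
    simp only [← mul_assoc, neg_mul] at h1 ⊢
    rw [h1, Real.mul_rpow hs.le (by positivity), ← Real.rpow_mul hx.le, inv_mul_cancel₀ hα.ne']
    simp [mul_comm]
  have h2 : P {ω | D x.toNNReal ω ≤ d} = P {ω | x ^ α⁻¹ * (D 1 ω : ℝ) ≤ d} := by
    have := congrArg (fun ν => ν (Set.Iic (d : ℝ))) hlaw
    simp only [Measure.map_apply (hm _) measurableSet_Iic,
      Measure.map_apply ((hm 1).const_mul _) measurableSet_Iic] at this
    simpa [Set.preimage] using this
  rw [h2]
  refine measure_congr ?_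
  filter_upwards [hD.ae_pos hα] with ω hω
  have hω' : (0 : ℝ) < D 1 ω := by exact_mod_cast hω
  refine propext ?_
  change x ^ α⁻¹ * (D 1 ω : ℝ) ≤ d ↔ x ≤ ((d : ℝ) / (D 1 ω : ℝ)) ^ α
  rw [← le_div_iff₀ hω', Real.rpow_inv_le_iff_of_pos hx.le (by positivity) hα]

/-- Almost surely `{H(d) > x} ⊆ {D(x) ≤ d} ⊆ {H(d) ≥ x}`, with `H` the first passage time, and the
outer events have equal probability for almost every `x`. By self-similarity `H(d)` and `(d / D(1))
^ α` have the same tails, and the layer-cake formula concludes. -/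
theorem IsStableSubordinator.lintegral_firstPassage_rpow [IsProbabilityMeasure P] {α : ℝ}
    (hα : 0 < α) {D : ℝ≥0 → Ω → ℝ≥0} (hD : IsStableSubordinator α D P) (d : ℝ≥0) {p : ℝ}
    (hp : 0 < p) :
    ∫⁻ ω, ENNReal.ofReal ((firstPassage D d ω : ℝ) ^ p) ∂P =
      ∫⁻ ω, ENNReal.ofReal ((((d : ℝ) / (D 1 ω : ℝ)) ^ α) ^ p) ∂P := by
  have hm := fun x => hD.subordinator.measurable_coe x
  have hY : AEMeasurable (fun ω => (firstPassage D d ω : ℝ)) P :=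
    (hD.aemeasurable_firstPassage d).coe_nnreal_real
  rw [lintegral_rpow_eq_lintegral_meas_le_mul P (ae_of_all _ fun ω => NNReal.coe_nonneg _) hY hp,
    lintegral_rpow_eq_lintegral_meas_le_mul P (ae_of_all _ fun ω => by positivity)
      (((hm 1).const_div _).pow_const α).aemeasurable hp]
  congr 1
  refine lintegral_congr_ae ?_
  filter_upwards [meas_le_ae_eq_meas_lt P (volume.restrict (Set.Ioi 0))
    (fun ω => (firstPassage D d ω : ℝ)), ae_restrict_mem measurableSet_Ioi] with x hx hx0
  congr 1
  rw [← hD.measure_le_eq hα hx0]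
  refine le_antisymm ?_ ?_
  · rw [hx]
    refine measure_mono_ae ?_
    refine ae_of_all _ fun ω hω => ?_
    change D x.toNNReal ω ≤ d
    by_contra! hlt
    have h1 : firstPassage D d ω ≤ x.toNNReal := firstPassage_le hlt
    have h2 : x < (firstPassage D d ω : ℝ) := hω
    rw [← NNReal.coe_le_coe, Real.coe_toNNReal _ hx0.le] at h1
    linarith
  · refine measure_mono_ae ?_
    filter_upwards [hD.subordinator.mono, hD.ae_unbounded] with ω hmono hunb hω
    change x ≤ (firstPassage D d ω : ℝ)
    by_contra! hlt
    have h1 : firstPassage D d ω < x.toNNReal := by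
      rwa [← NNReal.coe_lt_coe, Real.coe_toNNReal _ hx0.le]
    exact absurd (lt_of_firstPassage_lt hmono hunb h1) (not_lt.mpr hω)

theorem lintegral_rpow_mul_exp_neg_mul {q a : ℝ} (hq : 0 < q) (ha : 0 < a) :
    ∫⁻ s in Set.Ioi (0 : ℝ), ENNReal.ofReal (s ^ (q - 1) * Real.exp (-(a * s))) =
      ENNReal.ofReal (a ^ (-q) * Real.Gamma q) := by
  have h := Real.integral_rpow_mul_exp_neg_mul_Ioi hq ha
  rw [one_div, Real.inv_rpow ha.le, ← Real.rpow_neg ha.le] at h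
  rw [← h, ofReal_integral_eq_lintegral_ofReal]
  · refine Integrable.of_integral_ne_zero ?_
    rw [h]
    exact (mul_pos (Real.rpow_pos_of_pos ha _) (Real.Gamma_pos_of_pos hq)).ne'
  · filter_upwards [ae_restrict_mem measurableSet_Ioi] with s hs
    exact mul_nonneg (Real.rpow_nonneg (le_of_lt hs) _) (Real.exp_pos _).le

/-- With `q = nα`, write `Γ(q) D(1) ^ (-q) = ∫ s ^ (q - 1) exp (-s D(1)) ds` and apply Tonelli. The
Laplace transform leaves `∫ s ^ (q - 1) exp (-s ^ α) ds = Γ(n) / α`, and `Γ(n) / (α Γ(q)) = n! / Γ(q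
+ 1)`. -/
theorem IsStableSubordinator.lintegral_rpow_neg [IsProbabilityMeasure P] {α : ℝ}
    (hα : 0 < α) {D : ℝ≥0 → Ω → ℝ≥0} (hD : IsStableSubordinator α D P) {n : ℕ} (hn : 0 < n) :
    ∫⁻ ω, ENNReal.ofReal ((D 1 ω : ℝ) ^ (-((n : ℝ) * α))) ∂P =
      ENNReal.ofReal ((n.factorial : ℝ) / Real.Gamma ((n : ℝ) * α + 1)) := by
  have hm := hD.subordinator.measurable_coe 1
  have hn' : (0 : ℝ) < n := by exact_mod_cast hn
  set q : ℝ := (n : ℝ) * α with hq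
  have hq0 : 0 < q := by positivity
  have hG := Real.Gamma_pos_of_pos hq0
  have h1 : ∫⁻ ω, ENNReal.ofReal ((D 1 ω : ℝ) ^ (-q)) * ENNReal.ofReal (Real.Gamma q) ∂P =
      ∫⁻ ω, (∫⁻ s in Set.Ioi (0 : ℝ),
        ENNReal.ofReal (s ^ (q - 1) * Real.exp (-((D 1 ω : ℝ) * s)))) ∂P := by
    refine lintegral_congr_ae ?_
    filter_upwards [hD.ae_pos hα] with ω hω
    have hω' : (0 : ℝ) < D 1 ω := by exact_mod_cast hω
    rw [lintegral_rpow_mul_exp_neg_mul hq0 hω', ENNReal.ofReal_mul (by positivity)]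
  have h2 : ∫⁻ ω, (∫⁻ s in Set.Ioi (0 : ℝ),
        ENNReal.ofReal (s ^ (q - 1) * Real.exp (-((D 1 ω : ℝ) * s)))) ∂P =
      ∫⁻ s in Set.Ioi (0 : ℝ), ENNReal.ofReal (s ^ (q - 1) * Real.exp (-s ^ α)) := by
    have hjoint : Measurable fun p : Ω × ℝ =>
        ENNReal.ofReal (p.2 ^ (q - 1) * Real.exp (-((D 1 p.1 : ℝ) * p.2))) :=
      ((measurable_snd.pow_const _).mul
        ((hm.comp measurable_fst).mul measurable_snd).neg.exp).ennreal_ofReal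
    rw [lintegral_lintegral_swap hjoint.aemeasurable]
    refine setLIntegral_congr_fun measurableSet_Ioi fun s hs => ?_
    have hs0 : (0 : ℝ) ≤ s ^ (q - 1) := Real.rpow_nonneg (le_of_lt hs) _
    simp only [ENNReal.ofReal_mul hs0]
    rw [lintegral_const_mul _ (by fun_prop)]
    congr 1
    have h3 := hD.lintegral_exp_neg 1 hs
    rw [NNReal.coe_one, neg_mul, one_mul] at h3
    rw [← h3]
    refine lintegral_congr fun ω => ?_
    congr 2
    ring
  have h3 : ∫⁻ s in Set.Ioi (0 : ℝ), ENNReal.ofReal (s ^ (q - 1) * Real.exp (-s ^ α)) =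
      ENNReal.ofReal (1 / α * Real.Gamma n) := by
    have h := integral_rpow_mul_exp_neg_rpow (p := α) (q := q - 1) hα (by linarith)
    rw [sub_add_cancel, hq, mul_div_cancel_right₀ _ hα.ne', ← hq] at h
    rw [← h, ofReal_integral_eq_lintegral_ofReal]
    · refine Integrable.of_integral_ne_zero ?_
      rw [h]
      exact (mul_pos (by positivity) (Real.Gamma_pos_of_pos hn')).ne'
    · filter_upwards [ae_restrict_mem measurableSet_Ioi] with s hs
      exact mul_nonneg (Real.rpow_nonneg (le_of_lt hs) _) (Real.exp_pos _).le
  rw [h2, h3, lintegral_mul_const _ (by fun_prop)] at h1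
  have hGne : ENNReal.ofReal (Real.Gamma q) ≠ 0 := by simpa using hG
  rw [(ENNReal.eq_div_iff hGne ENNReal.ofReal_ne_top).mpr ((mul_comm _ _).trans h1),
    ← ENNReal.ofReal_div_of_pos hG, Real.Gamma_add_one hq0.ne', ← Nat.sub_add_cancel hn,
    Nat.factorial_succ, Nat.cast_mul, Nat.sub_add_cancel hn]
  congr 1
  have hfac : Real.Gamma n = ((n - 1).factorial : ℝ) := by
    have := Real.Gamma_nat_eq_factorial (n - 1)
    rw [← Nat.cast_add_one, Nat.sub_add_cancel hn] at this
    exact this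
  rw [hfac, hq]
  field_simp

theorem IsStableSubordinator.firstPassage_moment [IsProbabilityMeasure P] {α : ℝ}
    (hα : 0 < α) {D : ℝ≥0 → Ω → ℝ≥0} (hD : IsStableSubordinator α D P) (d : ℝ≥0) (n : ℕ) :
    Integrable (fun ω => (firstPassage D d ω : ℝ) ^ n) P ∧
      ∫ ω, (firstPassage D d ω : ℝ) ^ n ∂P =
        (n.factorial : ℝ) / Real.Gamma ((n : ℝ) * α + 1) * (d : ℝ) ^ ((n : ℝ) * α) := by
  rcases Nat.eq_zero_or_pos n with rfl | hn
  · simp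
  have hn' : (0 : ℝ) < n := by exact_mod_cast hn
  have hm := hD.subordinator.measurable_coe 1
  have hY : AEMeasurable (fun ω => (firstPassage D d ω : ℝ)) P :=
    (hD.aemeasurable_firstPassage d).coe_nnreal_real
  have hΓ : 0 < Real.Gamma ((n : ℝ) * α + 1) := Real.Gamma_pos_of_pos (by positivity)
  have h1 : ∫⁻ ω, ENNReal.ofReal ((firstPassage D d ω : ℝ) ^ n) ∂P = ENNReal.ofReal
      ((n.factorial : ℝ) / Real.Gamma ((n : ℝ) * α + 1) * (d : ℝ) ^ ((n : ℝ) * α)) := by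
    have h2 := hD.lintegral_firstPassage_rpow hα d hn'
    simp only [Real.rpow_natCast] at h2
    rw [h2, mul_comm ((n.factorial : ℝ) / _), ENNReal.ofReal_mul (by positivity),
      ← hD.lintegral_rpow_neg hα hn, ← lintegral_const_mul _ (by fun_prop)]
    refine lintegral_congr fun ω => ?_
    rw [← ENNReal.ofReal_mul (by positivity), ← Real.rpow_natCast, ← Real.rpow_mul (by positivity),
      Real.div_rpow (by positivity) (by positivity), Real.rpow_neg (by positivity), mul_comm α,
      div_eq_mul_inv]
  have hmeas := (hY.pow_const n).aestronglyMeasurable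
  have hnn : 0 ≤ᵐ[P] fun ω => (firstPassage D d ω : ℝ) ^ n := ae_of_all _ fun ω => by positivity
  refine ⟨⟨hmeas, ?_⟩, ?_⟩
  · rw [hasFiniteIntegral_iff_ofReal hnn, h1]
    exact ENNReal.ofReal_lt_top
  · rw [integral_eq_lintegral_of_nonneg_ae hnn hmeas, h1, ENNReal.toReal_ofReal (by positivity)]

end StableSubordinator

/-! ### Moments of the fractional process -/

section TimeChangedMoments

variable {Ω : Type*} [MeasurableSpace Ω] {P : Measure Ω}

theorem ae_continuousWithinAt_of_levy_natCast {M : ℝ≥0 → Ω → ℕ}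
    (hM : IsLevyProcess (fun t ω => (M t ω : ℝ)) P) :
    ∀ᵐ ω ∂P, ∀ t, ContinuousWithinAt (fun s => M s ω) (Set.Ici t) t := by
  filter_upwards [hM.cadlag] with ω hω t
  exact (Nat.isClosedEmbedding_coe_real.isInducing.tendsto_nhds_iff).mpr (hω t).1

theorem ae_continuousWithinAt_gsp {M₁ M₂ : ℝ≥0 → Ω → ℕ} {k : ℕ} {lam mu : ℕ → ℝ}
    (hM₁ : IsGCP k lam M₁ P) (hM₂ : IsGCP k mu M₂ P) :
    ∀ᵐ ω ∂P, ∀ t, ContinuousWithinAt (fun s => gsp M₁ M₂ s ω) (Set.Ici t) t := by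
  filter_upwards [ae_continuousWithinAt_of_levy_natCast hM₁.levy,
    ae_continuousWithinAt_of_levy_natCast hM₂.levy] with ω h1 h2 t
  have hc : Continuous fun p : ℕ × ℕ => (p.1 : ℤ) - (p.2 : ℤ) := continuous_of_discreteTopology
  exact hc.continuousAt.comp_continuousWithinAt ((h1 t).prodMk (h2 t))

theorem IsStableSubordinator.ae_continuousWithinAt_comp_firstPassage [IsProbabilityMeasure P]
    {α : ℝ} {D : ℝ≥0 → Ω → ℝ≥0} (hD : IsStableSubordinator α D P) {X : ℝ≥0 → Ω → ℤ}
    (hX : ∀ᵐ ω ∂P, ∀ t, ContinuousWithinAt (fun s => X s ω) (Set.Ici t) t) :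
    ∀ᵐ ω ∂P, ∀ t, ContinuousWithinAt (fun s => X (firstPassage D s ω) ω) (Set.Ici t) t := by
  filter_upwards [hX, hD.subordinator.mono, hD.ae_unbounded] with ω hω hmono hunb t
  exact (hω _).comp (firstPassage_continuousWithinAt hmono hunb t)
    fun s hs => firstPassage_monotone hunb hs

/-- The image of a polynomial moment function under averaging over an inverse stable subordinator:
`yⁿ` is sent to `n! d ^ (n α) / Γ(n α + 1)`. -/
noncomputable def fractionalEval (α : ℝ) (q : Polynomial ℝ) (d : ℝ≥0) : ℝ :=
  q.sum fun n a =>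
    a * ((n.factorial : ℝ) / Real.Gamma ((n : ℝ) * α + 1) * (d : ℝ) ^ ((n : ℝ) * α))

theorem measurable_fractionalEval (α : ℝ) (q : Polynomial ℝ) : Measurable (fractionalEval α q) := by
  unfold fractionalEval Polynomial.sum
  fun_prop

theorem fractionalEval_one (q : Polynomial ℝ) (d : ℝ≥0) : fractionalEval 1 q d = q.eval (d : ℝ) := by
  rw [Polynomial.eval_eq_sum, fractionalEval]
  congr 1
  ext n a
  rw [mul_one, Real.Gamma_nat_eq_factorial, div_self (by positivity), one_mul, Real.rpow_natCast]

theorem integral_eval_firstPassage [IsProbabilityMeasure P] {α : ℝ} (hα : 0 < α)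
    {D : ℝ≥0 → Ω → ℝ≥0} (hD : IsStableSubordinator α D P) (q : Polynomial ℝ) (d : ℝ≥0) :
    Integrable (fun ω => q.eval (firstPassage D d ω : ℝ)) P ∧
      ∫ ω, q.eval (firstPassage D d ω : ℝ) ∂P = fractionalEval α q d := by
  have h := fun n => hD.firstPassage_moment hα d n
  simp only [Polynomial.eval_eq_sum, fractionalEval, Polynomial.sum]
  refine ⟨integrable_finsetSum _ fun n _ => (h n).1.const_mul _, ?_⟩
  rw [integral_finsetSum _ fun n _ => (h n).1.const_mul _]
  exact Finset.sum_congr rfl fun n _ => by rw [integral_const_mul, (h n).2]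

theorem integrable_fractionalEval [IsProbabilityMeasure P] {α : ℝ} (hα : 0 < α)
    {T : Ω → ℝ≥0} (hT : ∀ q : ℝ, 0 < q → Integrable (fun ω => (T ω : ℝ) ^ q) P)
    (q : Polynomial ℝ) (n : ℕ) :
    Integrable (fun ω => q.coeff n * ((n.factorial : ℝ) / Real.Gamma ((n : ℝ) * α + 1)
      * (T ω : ℝ) ^ ((n : ℝ) * α))) P := by
  refine Integrable.const_mul (Integrable.const_mul ?_ _) _
  rcases Nat.eq_zero_or_pos n with rfl | hn
  · simp
  · exact hT _ (mul_pos (by exact_mod_cast hn) hα)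

theorem abs_le_one_add_sq (x : ℝ) : |x| ≤ 1 + x ^ 2 := by
  rw [← sq_abs]
  nlinarith [sq_nonneg (|x| - 1), abs_nonneg x]

theorem integral_abs_eval_le [IsProbabilityMeasure P] {N : Ω → ℤ} {f : Polynomial ℝ}
    (h1 : Integrable (fun ω => f.eval (N ω : ℝ)) P)
    (h2 : Integrable (fun ω => (f ^ 2).eval (N ω : ℝ)) P) :
    ∫ ω, |f.eval (N ω : ℝ)| ∂P ≤ 1 + ∫ ω, (f ^ 2).eval (N ω : ℝ) ∂P := by
  have h3 : ∫ ω, (1 + (f ^ 2).eval (N ω : ℝ)) ∂P = 1 + ∫ ω, (f ^ 2).eval (N ω : ℝ) ∂P := by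
    rw [integral_add (integrable_const _) h2]
    simp
  rw [← h3]
  refine integral_mono h1.abs ((integrable_const _).add h2) fun ω => ?_
  simpa using abs_le_one_add_sq (f.eval (N ω : ℝ))

variable [IsProbabilityMeasure P] {k : ℕ} {lam mu : ℕ → ℝ} {α : ℝ}
  {M₁ M₂ : ℝ≥0 → Ω → ℕ} {Dst : ℝ≥0 → Ω → ℝ≥0}

theorem aemeasurable_gfsp (hM₁ : IsGCP k lam M₁ P) (hM₂ : IsGCP k mu M₂ P) (hα1 : α ≤ 1)
    (hDst : α < 1 → IsStableSubordinator α Dst P) (d : ℝ≥0) :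
    AEMeasurable (gfsp α (gsp M₁ M₂) Dst d) P := by
  rcases hα1.eq_or_lt with rfl | hα
  · have h : AEMeasurable (gsp M₁ M₂ d) P := (measurable_gsp hM₁ hM₂ d).aemeasurable
    exact h.congr (ae_of_all _ fun ω => by simp [gfsp])
  · have h := aemeasurable_comp_randomTime (fun t => (measurable_gsp hM₁ hM₂ t).aemeasurable)
      (ae_continuousWithinAt_gsp hM₁ hM₂) ((hDst hα).aemeasurable_firstPassage d)
    refine h.congr (ae_of_all _ fun ω => ?_)
    rw [gfsp, if_neg hα.ne]

theorem ae_continuousWithinAt_gfsp (hM₁ : IsGCP k lam M₁ P) (hM₂ : IsGCP k mu M₂ P) (hα1 : α ≤ 1)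
    (hDst : α < 1 → IsStableSubordinator α Dst P) :
    ∀ᵐ ω ∂P, ∀ t, ContinuousWithinAt (fun s => gfsp α (gsp M₁ M₂) Dst s ω) (Set.Ici t) t := by
  have h := ae_continuousWithinAt_gsp hM₁ hM₂
  rcases hα1.eq_or_lt with rfl | hα
  · simpa only [gfsp, if_true] using h
  · simpa only [gfsp, if_neg hα.ne] using
      (hDst hα).ae_continuousWithinAt_comp_firstPassage h

/-- For `α < 1`, average `q` over the independent inverse, using the polynomial moment of `f ^ 2` as
control; for `α = 1` there is no time change and `fractionalEval` is ordinary evaluation. -/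
theorem integral_eval_gfsp (hM₁ : IsGCP k lam M₁ P) (hM₂ : IsGCP k mu M₂ P)
    (hM : IndepFun (fun ω t => M₁ t ω) (fun ω t => M₂ t ω) P) (hα0 : 0 < α) (hα1 : α ≤ 1)
    (hDst : α < 1 → IsStableSubordinator α Dst P)
    (hSY : α < 1 → IndepFun (fun ω t => gsp M₁ M₂ t ω) (fun ω t => firstPassage Dst t ω) P)
    {f q : Polynomial ℝ}
    (hq : ∀ y : ℝ≥0, ∫ ω, f.eval ((gsp M₁ M₂ y ω : ℤ) : ℝ) ∂P = q.eval (y : ℝ)) (d : ℝ≥0) :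
    Integrable (fun ω => f.eval ((gfsp α (gsp M₁ M₂) Dst d ω : ℤ) : ℝ)) P ∧
      ∫ ω, f.eval ((gfsp α (gsp M₁ M₂) Dst d ω : ℤ) : ℝ) ∂P = fractionalEval α q d := by
  obtain ⟨hf, -⟩ := exists_polynomial_integral_eval_gsp hM₁ hM₂ hM f
  rcases hα1.eq_or_lt with rfl | hα
  · simp only [gfsp, if_true, fractionalEval_one]
    exact ⟨hf d, hq d⟩
  · obtain ⟨hf2, q2, hq2⟩ := exists_polynomial_integral_eval_gsp hM₁ hM₂ hM (f ^ 2)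
    have hI := fun q => integral_eval_firstPassage hα0 (hDst hα) q d
    simp only [gfsp, if_neg hα.ne]
    rw [← (hI q).2]
    exact integral_comp_randomTime (g := fun s : ℤ => f.eval (s : ℝ))
      (B := fun y => 1 + q2.eval (y : ℝ)) (m := fun y => q.eval (y : ℝ))
      (fun t => (measurable_gsp hM₁ hM₂ t).aemeasurable)
      (ae_continuousWithinAt_gsp hM₁ hM₂) ((hDst hα).aemeasurable_firstPassage d)
      ((hSY hα).comp measurable_id (measurable_pi_apply d)) hf
      (by have := q2.continuous.measurable; fun_prop)
      (fun y => by rw [← hq2]; exact integral_abs_eval_le (hf y) (hf2 y))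
      ((integrable_const _).add (hI q2).1) (by have := q.continuous.measurable; fun_prop) hq

theorem momentCoeff_zero_left {r : ℕ} (hr : 1 ≤ r) : momentCoeff k lam mu 0 r = 0 := by
  obtain ⟨s, rfl⟩ := Nat.exists_eq_add_of_le' hr
  simp [momentCoeff, posTuples]

theorem momentCoeff_eq (n r : ℕ) : momentCoeff k lam mu n r =
    ∑ m ∈ posTuples n r, ∏ l : Fin n, (1 / ((m l).factorial : ℝ) * ∑ j ∈ Finset.Icc 1 k,
      ((j.descFactorial (m l) : ℝ) * lam j
        + (-1 : ℝ) ^ (m l) * (j.ascFactorial (m l) : ℝ) * mu j)) := by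
  refine Finset.sum_congr rfl fun m hm => Finset.prod_congr rfl fun l _ => ?_
  have h := (Finset.mem_filter.mp hm).2 l
  rw [exponentCoeff, if_neg (by omega)]

end TimeChangedMoments

end Skellam

/-! ### Factorial moments after the outer time change -/

theorem mainTheorem6 {Ω : Type*} [MeasurableSpace Ω] (P : Measure Ω) [IsProbabilityMeasure P]
    (k : ℕ) (hk : 1 ≤ k) (lam mu : ℕ → ℝ)
    (hlam : ∀ j ∈ Finset.Icc 1 k, 0 < lam j) (hmu : ∀ j ∈ Finset.Icc 1 k, 0 < mu j)
    (α : ℝ) (hα0 : 0 < α) (hα1 : α ≤ 1)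
    (M₁ M₂ : ℝ≥0 → Ω → ℕ) (Dst D : ℝ≥0 → Ω → ℝ≥0)
    -- the two independent generalized counting processes
    (hM₁ : Skellam.IsGCP k lam M₁ P) (hM₂ : Skellam.IsGCP k mu M₂ P)
    (hM : IndepFun (fun ω t => M₁ t ω) (fun ω t => M₂ t ω) P)
    -- for `α < 1`: the stable subordinator, whose inverse is independent of `M₁ - M₂`
    (hDst : α < 1 → Skellam.IsStableSubordinator α Dst P)
    (hSY : α < 1 → IndepFun (fun ω t => Skellam.gsp M₁ M₂ t ω)
      (fun ω t => Skellam.firstPassage Dst t ω) P)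
    -- the subordinator with finite moments, independent of the fractional Skellam process
    (hD : Skellam.IsSubordinator D P)
    (hDmom : ∀ (t : ℝ≥0) (q : ℝ), 0 < q → Integrable (fun ω => (D t ω : ℝ) ^ q) P)
    (hSD : IndepFun (fun ω t => Skellam.gfsp α (Skellam.gsp M₁ M₂) Dst t ω)
      (fun ω t => D t ω) P)
    (r : ℕ) (hr : 1 ≤ r) (t : ℝ≥0) :
    Integrable (fun ω => (((descPochhammer ℤ r).eval
      (Skellam.timeChange (Skellam.gfsp α (Skellam.gsp M₁ M₂) Dst) D t ω) : ℤ) : ℝ)) P ∧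
    ∫ ω, (((descPochhammer ℤ r).eval
        (Skellam.timeChange (Skellam.gfsp α (Skellam.gsp M₁ M₂) Dst) D t ω) : ℤ) : ℝ) ∂P =
      (r.factorial : ℝ) * ∑ n ∈ Finset.Icc 1 r,
        (∫ ω, (D t ω : ℝ) ^ ((n : ℝ) * α) ∂P) / Real.Gamma ((n : ℝ) * α + 1) *
          ∑ m ∈ Skellam.posTuples n r, ∏ l : Fin n,
            (1 / ((m l).factorial : ℝ) * ∑ j ∈ Finset.Icc 1 k,
              ((j.descFactorial (m l) : ℝ) * lam j
                + (-1 : ℝ) ^ (m l) * (j.ascFactorial (m l) : ℝ) * mu j)) := by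
  open Skellam in
  set f : Polynomial ℝ := descPochhammer ℝ r with hf
  obtain ⟨-, q2, hq2⟩ := exists_polynomial_integral_eval_gsp hM₁ hM₂ hM (f ^ 2)
  have h1 := integral_eval_gfsp hM₁ hM₂ hM hα0 hα1 hDst hSY
    (integral_descPochhammer_gsp hM₁ hM₂ hM r)
  have h2 := integral_eval_gfsp hM₁ hM₂ hM hα0 hα1 hDst hSY hq2
  have hI := integrable_fractionalEval hα0 (hDmom t)
  -- The second averaging, now over `D t`; the bound is integrable because all positive moments of
  -- `D t` are finite.
  have hmain := integral_comp_randomTime (P := P) (X := gfsp α (gsp M₁ M₂) Dst) (T := D t)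
    (g := fun s : ℤ => f.eval (s : ℝ)) (B := fun d => 1 + fractionalEval α q2 d)
    (aemeasurable_gfsp hM₁ hM₂ hα1 hDst) (ae_continuousWithinAt_gfsp hM₁ hM₂ hα1 hDst)
    (hD.measurable t).aemeasurable (hSD.comp measurable_id (measurable_pi_apply t))
    (fun d => (h1 d).1) ((measurable_fractionalEval α q2).const_add 1)
    (fun d => by rw [← (h2 d).2]; exact integral_abs_eval_le (h1 d).1 (h2 d).1)
    ((integrable_const _).add (integrable_finsetSum _ fun n _ => hI q2 n))
    (measurable_fractionalEval α _) (fun d => (h1 d).2)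
  have hcast : ∀ s : ℤ, (((descPochhammer ℤ r).eval s : ℤ) : ℝ) = f.eval (s : ℝ) := fun s => by
    rw [descPochhammer_eval_intCast, hf, descPochhammer_eval_eq_choose]
  simp only [hcast, timeChange]
  refine ⟨hmain.1, hmain.2.trans ?_⟩
  have hsum : ∀ d : ℝ≥0, fractionalEval α (momentPolynomial k lam mu r) d =
      ∑ n ∈ Finset.range (r + 1), (momentPolynomial k lam mu r).coeff n *
        ((n.factorial : ℝ) / Real.Gamma ((n : ℝ) * α + 1) * (d : ℝ) ^ ((n : ℝ) * α)) := fun d =>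
    Polynomial.sum_over_range' _ (fun n => zero_mul _) (r + 1)
      (momentPolynomial_natDegree_lt k lam mu r)
  simp only [hsum]
  -- The term `n = 0` drops out: the empty tuple has sum `0`, not `r ≥ 1`.
  rw [integral_finsetSum _ fun n _ => hI _ n, Finset.range_eq_Ico,
    Finset.sum_eq_sum_Ico_succ_bot (Nat.succ_pos r), momentPolynomial_coeff _ _ _ (by simp),
    momentCoeff_zero_left hr, Finset.mul_sum]
  simp only [mul_zero, zero_mul, integral_zero, zero_add]
  refine Finset.sum_congr rfl fun n hn => ?_
  rw [momentPolynomial_coeff _ _ _ (by simp at hn ⊢; omega), integral_const_mul,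
    integral_const_mul, ← momentCoeff_eq]
  field_simp
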